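/- **Theorem 1.** Let $K\ge 1$, $\alpha,\mu,\phi,S_0,\hat h_f,N_0,R>0$ and $h_l\neq 0$. Let the envelopes $|h_{pf,1}|,\dots,|h_{pf,K}|$ be independent random variables, each with the probability density $$f(x)=\frac{\phi\,\mu^{\phi/\alpha}x^{\phi-1}}{S_0^{\phi}\hat h_f^{\phi}\Gamma(\mu)}\,\Gamma\!\left(\frac{\alpha\mu-\phi}{\alpha},\frac{\mu x^{\alpha}}{S_0^{\alpha}\hat h_f^{\alpha}}\right),\qquad x>0,$$ where $\Gamma(\cdot,\cdot)$ is the upper incomplete Gamma function. Let $\mathbf P=(P_1,\dots,P_K)$ be the transmit powers and $\rho_k=P_k/N_0$ the transmit SNRs, and assume $\rho_k=q_k\hat\rho$ with fixed $q_k>0$. The outage probability is $$p_{out,K}=\Pr\left\{\sum_{k=1}^K\log_2\left(1+\rho_k|h_l|^2|h_{pf,k}|^2\right)<R\right\}.$$ Assume $\mu\alpha\ne\phi$. Then, as $\hat\rho\to\infty$, $$p_{out,K}\simeq\mathcal A\,\mathcal L(\mathbf P)\,\mathcal C(R)^{-\mathcal D}$$ (the ratio of the two sides tends to $1$), where $$\mathcal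 A=\begin{cases}\left(\dfrac{\mu^{\phi/\alpha}\,\Gamma(\mu-\frac{\phi}{\alpha})\,N_0^{\phi/2}}{|h_l|^{\phi}\hat h_f^{\phi}S_0^{\phi}\Gamma(\mu)}\right)^{K},&\mu\alpha-\phi>0,\\[3mm]\left(\dfrac{\phi\,\mu^{\mu-1}N_0^{\mu\alpha/2}}{(\phi-\mu\alpha)|h_l|^{\mu\alpha}\hat h_f^{\mu\alpha}S_0^{\mu\alpha}\Gamma(\mu)}\right)^{K},&\mu\alpha-\phi<0,\end{cases}\qquad \mathcal L(\mathbf P)=\Big(\prod_{k=1}^KP_k\Big)^{-\min\{\phi,\alpha\mu\}/2},$$ $\mathcal C(R)=\mathcal G_K(2^R)^{-1/\mathcal D}$ with, for $\delta=\min\{\phi,\alpha\mu\}/2$, $$\mathcal G_K(2^R)=\Gamma(\delta+1)^K\,G^{0,K}_{K,K}\!\left(2^R\,\middle|\,{1+\delta,\,1+\delta,\dots,1+\delta\atop 0,\,1,\dots,1}\right)$$ ($K$ upper parameters $1+\delta$; lower parameters one $0$ and $K-1$ ones). Here $G^{0,K}_{K,K}$ is the Meijer G-function, given for these parameters by the absolutely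 convergent Mellin–Barnes integral $\frac1{2\pi\mathrm i}\int_{c-\mathrm i\infty}^{c+\mathrm i\infty}\frac{\Gamma(s-\delta)^K}{\Gamma(1+s)\Gamma(s)^{K-1}}2^{Rs}\,ds$ with any $c>\delta$; its value is real and positive. Moreover $$\mathcal D=\frac{K\min\{\phi,\alpha\mu\}}2$$ is the diversity order, that is, $\mathcal D=-\lim_{\hat\rho\to\infty}\log p_{out,K}/\log\hat\rho$. -/

import Mathlib

open MeasureTheory ProbabilityTheory Filter Asymptotics Topology

noncomputable section

namespace HARQ

/-- The upper incomplete Gamma function `Γ(a, x) = ∫_x^∞ t^(a-1) e^(-t) dt`, for `x > 0` and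
any real `a`. -/
def upperGamma (a x : ℝ) : ℝ :=
  ∫ t in Set.Ioi x, t ^ (a - 1) * Real.exp (-t)

/-- The probability density of `|h_pf|` (the product of the pointing error and of the `α`-`μ`
multipath fading), with values in `[0, ∞]`; it vanishes off `(0, ∞)`. -/
def fadingPDF (α μ φ S₀ hf : ℝ) (x : ℝ) : ENNReal :=
  if 0 < x then
    ENNReal.ofReal
      (φ * μ ^ (φ / α) * x ^ (φ - 1) / (S₀ ^ φ * hf ^ φ * Real.Gamma μ)
        * upperGamma ((α * μ - φ) / α) (μ * x ^ α / (S₀ ^ α * hf ^ α)))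
  else 0

/-- The accumulated mutual information `∑ₖ log₂ (1 + ρₖ |h_l|² |h_{pf,k}|²)` after `K` rounds. -/
def mutualInfo {K : ℕ} (hl : ℂ) (ρ : Fin K → ℝ) (h : Fin K → ℂ) : ℝ :=
  ∑ k, Real.logb 2 (1 + ρ k * ‖hl‖ ^ 2 * ‖h k‖ ^ 2)

/-- The outage probability `Pr {I_K < R}` for noise variance `N₀` and transmit powers
`P₁, …, P_K`; the transmit SNR of round `k` is `ρₖ = Pₖ / N₀`. -/
def outageProb {Ω : Type*} [MeasurableSpace Ω] (ν : Measure Ω) {K : ℕ} (hl : ℂ) (N₀ : ℝ)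
    (hpf : Fin K → Ω → ℂ) (R : ℝ) (P : Fin K → ℝ) : ℝ :=
  ν.real {ω | mutualInfo hl (fun k => P k / N₀) (fun k => hpf k ω) < R}

/-- The Mellin–Barnes integrand of the Meijer G-function `G^{m,n}_{p,q}(z | a; b)`:
`∏_{j ≤ m} Γ(b_j - s) ∏_{j ≤ n} Γ(1 - a_j + s) z^s /
  (∏_{m < j ≤ q} Γ(1 - b_j + s) ∏_{n < j ≤ p} Γ(a_j - s))`. -/
def meijerIntegrand {p q : ℕ} (m n : ℕ) (a : Fin p → ℂ) (b : Fin q → ℂ) (z s : ℂ) : ℂ :=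
  (∏ j : Fin q, if (j : ℕ) < m then Complex.Gamma (b j - s)
      else (Complex.Gamma (1 - b j + s))⁻¹) *
  (∏ j : Fin p, if (j : ℕ) < n then Complex.Gamma (1 - a j + s)
      else (Complex.Gamma (a j - s))⁻¹) * z ^ s

/-- The vertical line `Re s = c` separates the poles of the `Γ(1 - a_j + s)`, `j ≤ n` (on its
left) from the poles of the `Γ(b_j - s)`, `j ≤ m` (on its right). -/
def MeijerLine {p q : ℕ} (m n : ℕ) (a : Fin p → ℂ) (b : Fin q → ℂ) (c : ℝ) : Prop :=
  (∀ j : Fin q, (j : ℕ) < m → c < (b j).re) ∧ (∀ j : Fin p, (j : ℕ) < n → (a j).re - 1 < c)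

/-- The Mellin–Barnes integral `(1 / 2πi) ∫_{c - i∞}^{c + i∞} … ds` along `Re s = c`. -/
def meijerLineIntegral {p q : ℕ} (m n : ℕ) (a : Fin p → ℂ) (b : Fin q → ℂ) (z : ℂ) (c : ℝ) : ℂ :=
  (1 / (2 * Real.pi) : ℂ) * ∫ y : ℝ, meijerIntegrand m n a b z (c + y * Complex.I)

open Classical in
/-- The Meijer G-function `G^{m,n}_{p,q}(z | a; b)`, as the Mellin–Barnes integral along a vertical
line that separates the two families of poles. -/
def meijerG {p q : ℕ} (m n : ℕ) (a : Fin p → ℂ) (b : Fin q → ℂ) (z : ℂ) : ℂ :=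
  if h : ∃ c, MeijerLine m n a b c then meijerLineIntegral m n a b z h.choose else 0

/-- The integral that defines `G^{m,n}_{p,q}(z | a; b)` makes sense: separating vertical lines
exist, and along each of them the integral converges absolutely, with value `meijerG`. -/
def MeijerGConverges {p q : ℕ} (m n : ℕ) (a : Fin p → ℂ) (b : Fin q → ℂ) (z : ℂ) : Prop :=
  (∃ c, MeijerLine m n a b c) ∧ ∀ c, MeijerLine m n a b c →
    Integrable (fun y : ℝ => meijerIntegrand m n a b z (c + y * Complex.I)) ∧
      meijerLineIntegral m n a b z c = meijerG m n a b z

/-- The upper parameters `1 + δ, …, 1 + δ` (`K` entries). -/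
def upperParams (K : ℕ) (δ : ℝ) : Fin K → ℂ := fun _ => 1 + δ

/-- The lower parameters `0, 1, …, 1` (`K` entries). -/
def lowerParams (K : ℕ) : Fin K → ℂ := fun j => if (j : ℕ) = 0 then 0 else 1

/-- `G^{0,K}_{K,K}(2^R | 1 + δ, …, 1 + δ; 0, 1, …, 1)`. -/
def codingG (K : ℕ) (δ R : ℝ) : ℂ :=
  meijerG 0 K (upperParams K δ) (lowerParams K) (((2 : ℝ) ^ R : ℝ) : ℂ)

/-- `𝒢_K(2^R)`. -/
def calG (K : ℕ) (α μ φ R : ℝ) : ℝ :=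
  if 0 < μ * α - φ then
    Real.Gamma (φ / 2 + 1) ^ K * (codingG K (φ / 2) R).re
  else
    Real.Gamma (μ * α / 2 + 1) ^ K * (codingG K (μ * α / 2) R).re

/-- The diversity order `𝒟 = K min{φ, αμ} / 2`. -/
def diversity (K : ℕ) (α μ φ : ℝ) : ℝ := K * min φ (α * μ) / 2

/-- The modulation and coding gain `𝒞(R) = 𝒢_K(2^R)^(-1/𝒟)`. -/
def codingGain (K : ℕ) (α μ φ R : ℝ) : ℝ :=
  calG K α μ φ R ^ (-1 / diversity K α μ φ)

/-- The impact factor `𝒜` of pointing error and fading. -/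
def impactA (K : ℕ) (α μ φ S₀ hf N₀ : ℝ) (hl : ℂ) : ℝ :=
  if 0 < μ * α - φ then
    (μ ^ (φ / α) * Real.Gamma (μ - φ / α) * N₀ ^ (φ / 2) /
      (‖hl‖ ^ φ * hf ^ φ * S₀ ^ φ * Real.Gamma μ)) ^ K
  else
    (φ * μ ^ (μ - 1) * N₀ ^ (μ * α / 2) /
      ((φ - μ * α) * ‖hl‖ ^ (μ * α) * hf ^ (μ * α) * S₀ ^ (μ * α) * Real.Gamma μ)) ^ K

/-- The impact factor `ℒ(P)` of the power allocation. -/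
def impactL {K : ℕ} (α μ φ : ℝ) (P : Fin K → ℝ) : ℝ :=
  if 0 < μ * α - φ then (∏ k, P k) ^ (-(φ / 2)) else (∏ k, P k) ^ (-(μ * α / 2))

end HARQ

end

/-! Put `p = min φ (α * μ)` and `δ = p / 2`. Near the origin the envelope density is `w₀ p x^(p-1)
(1 + o(1))`, where `w₀` carries the fading constants. Scale each envelope by `bₖ = √ρₖ ‖hl‖`. Outage
then says that the scaled vector lies in the fixed region `∏ (1 + tₖ²) < 2^R`, and `bₖ^p` times its
`k`-th density tends to `w₀ p t^(p-1)`. The ratio of the density to `p x^(p-1)` is bounded, and the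
region is bounded in the positive orthant, so dominated convergence gives `∏ bₖ^p · p_out → w₀^K
V(2^R)`, where `V` is `outageVolume` (`tendsto_rpow_mul_measureReal_outageRegion`). Since `V(2^R) >
0`, both the equivalence and the diversity order follow.

It remains to see that `V(2^R)` is `calG`. By Fubini and a Beta integral, the Mellin transform of `x
↦ V(1/x)` is `(Γ(δ+1) Γ(s-δ) / Γ(s))^K / s` for `Re s > δ` (`mellin_outageVolume_inv`), which is
`Γ(δ+1)^K` times the Meijer integrand without its power of `z`. Mellin inversion
(`meijerLineIntegral_eq`) needs `V` continuous, which holds because the level sets are null, and the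
transform integrable on vertical lines. For the latter `1/s` alone just fails; any power decay of
`Γ(s-δ)/Γ(s)` suffices, and it comes from a bound on the Beta integral. -/

noncomputable section

namespace HARQ

/-! ### Decay of `Γ(s - δ) / Γ(s)` on vertical lines -/

/-- A bound for the Beta integral that trades the singularity at `1` against oscillation. -/
theorem norm_betaIntegral_le_of_split {u : ℂ} (hu : 0 < u.re) {δ τ : ℝ} (hδ : 0 < δ) (hδ1 : δ < 1)
    (hτ : 0 < τ) (hτ2 : τ ≤ 1 / 2) :
    ‖Complex.betaIntegral u δ‖ ≤ 2 * τ ^ (δ - 1) / ‖u‖ + 2 * τ ^ δ / δ := by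
  have hu0 : u ≠ 0 := by rintro rfl; simp at hu
  have hun : 0 < ‖u‖ := norm_pos_iff.2 hu0
  have hint := Complex.betaIntegral_convergent (v := (δ : ℂ)) hu (by simpa using hδ)
  have hint1 := hint.mono_set (c := 0) (d := 1 - τ) (by
    rw [Set.uIcc_of_le (by linarith), Set.uIcc_of_le (by linarith)]
    exact Set.Icc_subset_Icc le_rfl (by linarith))
  have hint2 := hint.mono_set (c := 1 - τ) (d := 1) (by
    rw [Set.uIcc_of_le (by linarith), Set.uIcc_of_le (by linarith)]
    exact Set.Icc_subset_Icc (by linarith) le_rfl)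
  rw [Complex.betaIntegral, ← intervalIntegral.integral_add_adjacent_intervals hint1 hint2]
  refine (norm_add_le _ _).trans (add_le_add ?_ ?_)
  -- Away from `1`, integrating `t^(u-1)` by parts gains `1/‖u‖`. The boundary term costs `τ^(δ-1)`
  -- and the total variation of `(1-t)^(δ-1)` costs `τ^(δ-1) - 1`.
  · have hb : (0 : ℝ) ≤ 1 - τ := by linarith
    have hd (t : ℝ) (ht : t ∈ Set.Icc 0 (1 - τ)) :
        HasDerivAt (fun t : ℝ => (1 - t) ^ (δ - 1)) ((1 - δ) * (1 - t) ^ (δ - 2)) t := by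
      have h1 : HasDerivAt (fun t : ℝ => 1 - t) (-1) t := by
        simpa using (hasDerivAt_id t).const_sub 1
      have := h1.rpow_const (p := δ - 1) (Or.inl (by linarith [ht.2]))
      convert this using 1
      rw [show δ - 1 - 1 = δ - 2 by ring]; ring
    have hc' : ContinuousOn (fun t : ℝ => (1 - δ) * (1 - t) ^ (δ - 2)) (Set.uIcc 0 (1 - τ)) := by
      rw [Set.uIcc_of_le hb]
      refine ContinuousOn.mul continuousOn_const (ContinuousOn.rpow_const (by fun_prop) ?_)
      intro t ht; left; linarith [ht.2]
    have hparts := intervalIntegral.integral_mul_deriv_eq_deriv_mul_of_hasDerivAt (a := 0)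
      (b := 1 - τ) (u := fun t : ℝ => (((1 - t) ^ (δ - 1) : ℝ) : ℂ))
      (u' := fun t : ℝ => (((1 - δ) * (1 - t) ^ (δ - 2) : ℝ) : ℂ))
      (v := fun t : ℝ => (t : ℂ) ^ u / u) (v' := fun t : ℝ => (t : ℂ) ^ (u - 1))
      (by
        rw [Set.uIcc_of_le hb]
        exact fun t ht => (hd t ht).ofReal_comp.continuousAt.continuousWithinAt)
      (by
        refine ContinuousOn.div_const ?_ _
        intro t _
        exact (Complex.continuousAt_ofReal_cpow_const t u (Or.inl hu)).continuousWithinAt)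
      (by
        rw [min_eq_left hb, max_eq_right hb]
        exact fun t ht => (hd t ⟨ht.1.le, ht.2.le⟩).ofReal_comp)
      (by
        rw [min_eq_left hb, max_eq_right hb]
        intro t ht
        have := hasDerivAt_ofReal_cpow_const' (x := t) ht.1.ne' (r := u - 1) (by
          intro h; exact hu0 (by linear_combination h))
        simpa using this)
      (ContinuousOn.intervalIntegrable (Complex.continuous_ofReal.comp_continuousOn hc'))
      (intervalIntegral.intervalIntegrable_cpow' (by simpa using hu))
    have hvle (t : ℝ) (ht : t ∈ Set.Icc 0 (1 - τ)) : ‖(t : ℂ) ^ u / u‖ ≤ 1 / ‖u‖ := by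
      rw [norm_div]
      gcongr
      rcases eq_or_lt_of_le ht.1 with h | h
      · rw [← h]; simp [Complex.zero_cpow hu0]
      · rw [Complex.norm_cpow_eq_rpow_re_of_pos h]
        exact Real.rpow_le_one h.le (by linarith [ht.2]) hu.le
    have heq : (∫ x : ℝ in 0..(1 - τ), (x : ℂ) ^ (u - 1) * (1 - (x : ℂ)) ^ ((δ : ℂ) - 1)) =
        ∫ x : ℝ in 0..(1 - τ), (((1 - x) ^ (δ - 1) : ℝ) : ℂ) * (x : ℂ) ^ (u - 1) := by
      refine intervalIntegral.integral_congr fun t ht => ?_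
      rw [Set.uIcc_of_le hb] at ht
      rw [mul_comm, Complex.ofReal_cpow (by linarith [ht.2])]
      push_cast; rfl
    rw [heq, hparts]
    have hftc : ∫ t in (0 : ℝ)..(1 - τ), (1 - δ) * (1 - t) ^ (δ - 2) = τ ^ (δ - 1) - 1 := by
      rw [intervalIntegral.integral_eq_sub_of_hasDerivAt (f := fun t : ℝ => (1 - t) ^ (δ - 1))
        (by rw [Set.uIcc_of_le hb]; exact hd) hc'.intervalIntegrable]
      simp
    have hI : ‖∫ t in (0 : ℝ)..(1 - τ), (((1 - δ) * (1 - t) ^ (δ - 2) : ℝ) : ℂ) * ((t : ℂ) ^ u / u)‖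
        ≤ (τ ^ (δ - 1) - 1) / ‖u‖ := by
      rw [← hftc, div_eq_mul_one_div, ← intervalIntegral.integral_mul_const]
      refine intervalIntegral.norm_integral_le_of_norm_le hb ?_
        (hc'.intervalIntegrable.mul_const _)
      refine ae_of_all _ fun t ht => ?_
      rw [norm_mul, Complex.norm_real, Real.norm_of_nonneg]
      · exact mul_le_mul_of_nonneg_left (hvle t ⟨ht.1.le, ht.2⟩)
          (mul_nonneg (by linarith) (Real.rpow_nonneg (by linarith [ht.2]) _))
      · exact mul_nonneg (by linarith) (Real.rpow_nonneg (by linarith [ht.2]) _)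
    have hτp : 0 < τ ^ (δ - 1) := Real.rpow_pos_of_pos hτ _
    have hB : ‖(((1 - (1 - τ)) ^ (δ - 1) : ℝ) : ℂ) * (((1 - τ : ℝ) : ℂ) ^ u / u)‖
        ≤ τ ^ (δ - 1) / ‖u‖ := by
      rw [norm_mul, Complex.norm_real, sub_sub_cancel, Real.norm_of_nonneg hτp.le,
        div_eq_mul_one_div (τ ^ (δ - 1))]
      exact mul_le_mul_of_nonneg_left (hvle _ ⟨hb, le_rfl⟩) hτp.le
    simp only [Complex.ofReal_zero, Complex.zero_cpow hu0, zero_div, mul_zero, sub_zero]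
    refine (norm_sub_le _ _).trans ((add_le_add hB hI).trans ?_)
    rw [← add_div]
    gcongr
    linarith
  -- Near `1`, absolute values are enough. The factor 2 bounds `t^(Re u - 1) ≤ 1/t`, as `t ≥ 1/2`.
  · have hpow : ∫ t in (1 - τ)..(1 : ℝ), 2 * (1 - t) ^ (δ - 1) = 2 * τ ^ δ / δ := by
      rw [intervalIntegral.integral_const_mul,
        intervalIntegral.integral_comp_sub_left (fun t => t ^ (δ - 1)) 1, sub_self, sub_sub_cancel,
        integral_rpow (Or.inl (by linarith)), sub_add_cancel, Real.zero_rpow hδ.ne']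
      ring
    rw [← hpow]
    refine intervalIntegral.norm_integral_le_of_norm_le (by linarith) ?_ ?_
    · have : ∀ᵐ t : ℝ, t ≠ 1 := by simp [ae_iff, measure_singleton]
      filter_upwards [this] with t ht1 ht
      have h1 : 0 < 1 - t := by
        rcases lt_or_eq_of_le ht.2 with h | h
        · linarith
        · exact absurd h ht1
      have h0 : 1 / 2 ≤ t := by linarith [ht.1]
      rw [norm_mul]
      refine mul_le_mul ?_ ?_ (norm_nonneg _) (by norm_num)
      · rw [Complex.norm_cpow_eq_rpow_re_of_pos (by linarith), Complex.sub_re, Complex.one_re,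
          Real.rpow_sub_one (by linarith), div_le_iff₀ (by linarith)]
        have := Real.rpow_le_one (by linarith) (by linarith : t ≤ 1) hu.le
        linarith
      · rw [← Complex.ofReal_one, ← Complex.ofReal_sub, ← Complex.ofReal_sub,
          Complex.norm_cpow_eq_rpow_re_of_pos h1, Complex.ofReal_re]
    · have := (intervalIntegral.intervalIntegrable_rpow' (a := τ) (b := 0)
        (r := δ - 1) (by linarith)).comp_sub_left 1
      simpa using this.const_mul 2

/-- The modulus of the integrand depends on `u` only through `u.re`. This gives a bound uniform
along a vertical line. -/
theorem norm_betaIntegral_le_betaIntegral_re {u : ℂ} (hu : 0 < u.re) {δ : ℝ} (hδ : 0 < δ) :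
    ‖Complex.betaIntegral u δ‖ ≤ ‖Complex.betaIntegral u.re δ‖ := by
  have hnn : Complex.betaIntegral u.re δ =
      ((∫ x in (0 : ℝ)..1, x ^ (u.re - 1) * (1 - x) ^ (δ - 1) : ℝ) : ℂ) := by
    rw [Complex.betaIntegral, ← intervalIntegral.integral_ofReal]
    refine intervalIntegral.integral_congr fun t ht => ?_
    rw [Set.uIcc_of_le zero_le_one] at ht
    rw [Complex.ofReal_mul, Complex.ofReal_cpow ht.1, Complex.ofReal_cpow (by linarith [ht.2])]
    push_cast; rfl
  have hint := (Complex.betaIntegral_convergent (u := u.re) (v := δ) (by simpa) (by simpa)).norm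
  have hcongr : ∀ t ∈ Set.Ioo (0 : ℝ) 1, ∀ v : ℂ,
      ‖(t : ℂ) ^ (v - 1) * (1 - (t : ℂ)) ^ ((δ : ℂ) - 1)‖ =
        t ^ (v.re - 1) * (1 - t) ^ (δ - 1) := by
    intro t ht v
    rw [norm_mul, Complex.norm_cpow_eq_rpow_re_of_pos ht.1, ← Complex.ofReal_one,
      ← Complex.ofReal_sub, ← Complex.ofReal_sub, Complex.norm_cpow_eq_rpow_re_of_pos
      (by linarith [ht.2]), Complex.ofReal_re, Complex.sub_re, Complex.ofReal_re]
  have hae : ∀ᵐ t : ℝ, t ≠ 1 := by simp [ae_iff, measure_singleton]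
  have hint' : IntervalIntegrable (fun x : ℝ => x ^ (u.re - 1) * (1 - x) ^ (δ - 1)) volume 0 1 := by
    refine hint.congr_ae ?_
    rw [Filter.EventuallyEq, ae_restrict_iff' measurableSet_uIoc]
    filter_upwards [hae] with t ht1 ht
    rw [Set.uIoc_of_le zero_le_one] at ht
    rw [hcongr t ⟨ht.1, lt_of_le_of_ne ht.2 ht1⟩]; simp
  rw [hnn, Complex.norm_real]
  refine le_trans ?_ (le_abs_self _)
  refine intervalIntegral.norm_integral_le_of_norm_le zero_le_one ?_ hint'
  filter_upwards [hae] with t ht1 ht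
  exact (hcongr t ⟨ht.1, lt_of_le_of_ne ht.2 ht1⟩ u).le

theorem exists_norm_betaIntegral_le {a δ : ℝ} (ha : 0 < a) (hδ : 0 < δ) (hδ1 : δ < 1) :
    ∃ C, ∀ y : ℝ, ‖Complex.betaIntegral (a + y * Complex.I) δ‖ ≤ C * (1 + |y|) ^ (-δ) := by
  set M := ‖Complex.betaIntegral a δ‖ with hM
  -- The first summand serves `|y| ≤ 2`, where `1 + |y| ≤ 3`; the second serves `|y| ≥ 2`, where `1
  -- + |y| ≤ 2|y|`.
  refine ⟨M * 3 ^ δ + (2 + 2 / δ) * 2 ^ δ, fun y => ?_⟩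
  have hre : ((a : ℂ) + y * Complex.I).re = a := by simp
  have hM0 : 0 ≤ M := norm_nonneg _
  have hy1 : 0 < 1 + |y| := by positivity
  rcases le_total |y| 2 with hy | hy
  · have h1 := norm_betaIntegral_le_betaIntegral_re (u := a + y * Complex.I) (by simpa) hδ
    rw [hre] at h1
    have h3 : (1 : ℝ) ≤ 3 ^ δ * (1 + |y|) ^ (-δ) := by
      rw [Real.rpow_neg hy1.le, ← div_eq_mul_inv, one_le_div (by positivity)]
      gcongr; linarith
    calc _ ≤ M * 1 := by simpa using h1
      _ ≤ M * (3 ^ δ * (1 + |y|) ^ (-δ)) := by gcongr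
      _ ≤ _ := by
        rw [← mul_assoc]
        gcongr
        have : 0 ≤ (2 + 2 / δ) * 2 ^ δ := by positivity
        linarith
  · have hyp : 0 < |y| := by linarith
    -- The choice `τ = 1/|y|` balances the two terms: both become multiples of `|y|^(-δ)`.
    have h1 := norm_betaIntegral_le_of_split (u := a + y * Complex.I) (δ := δ) (τ := 1 / |y|)
      (by simpa) hδ hδ1 (by positivity) (by gcongr)
    have hn : |y| ≤ ‖(a : ℂ) + y * Complex.I‖ := by
      have := Complex.abs_im_le_norm ((a : ℂ) + y * Complex.I)
      simpa using this
    have e1 : (1 / |y|) ^ (δ - 1) / |y| = |y| ^ (-δ) := by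
      rw [one_div, Real.inv_rpow hyp.le, ← Real.rpow_neg hyp.le, ← Real.rpow_sub_one hyp.ne']
      congr 1; ring
    have e2 : (1 / |y|) ^ δ = |y| ^ (-δ) := by
      rw [one_div, Real.inv_rpow hyp.le, ← Real.rpow_neg hyp.le]
    have h2 : |y| ^ (-δ) ≤ 2 ^ δ * (1 + |y|) ^ (-δ) := by
      rw [Real.rpow_neg hyp.le, Real.rpow_neg hy1.le, ← div_eq_mul_inv,
        le_div_iff₀ (by positivity), inv_mul_le_iff₀ (by positivity),
        ← Real.mul_rpow (by positivity) (by positivity)]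
      gcongr; linarith
    calc _ ≤ _ := h1
      _ ≤ 2 * ((1 / |y|) ^ (δ - 1) / |y|) + 2 / δ * (1 / |y|) ^ δ := by
        rw [mul_div_assoc, mul_div_right_comm]
        gcongr
      _ = (2 + 2 / δ) * |y| ^ (-δ) := by rw [e1, e2]; ring
      _ ≤ (2 + 2 / δ) * (2 ^ δ * (1 + |y|) ^ (-δ)) := by gcongr
      _ ≤ _ := by
        rw [← mul_assoc]
        gcongr
        have : 0 ≤ M * 3 ^ δ := by positivity
        linarith

theorem Gamma_sub_div_Gamma {s : ℂ} {δ : ℝ} (hδ : 0 < δ) (hs : δ < s.re) :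
    Complex.Gamma (s - δ) / Complex.Gamma s =
      Complex.betaIntegral (s - δ) δ / Complex.Gamma δ := by
  have h0 : Complex.Gamma δ ≠ 0 := Complex.Gamma_ne_zero_of_re_pos (by simpa)
  rw [Complex.betaIntegral_eq_Gamma_mul_div _ _ (by simpa) (by simpa), sub_add_cancel]
  field_simp

/-- The Beta bound needs an exponent below 1, so the quotient is split at `Γ(s - δ + ε)`: a step of
length `ε < 1` supplies the decay and the remaining step of length `δ - ε` stays bounded. -/
theorem exists_norm_Gamma_div_Gamma_le {c δ : ℝ} (hδ : 0 < δ) (hc : δ < c) :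
    ∃ C ε : ℝ, 0 ≤ C ∧ 0 < ε ∧ ∀ y : ℝ, ‖Complex.Gamma (c + y * Complex.I - δ) /
      Complex.Gamma (c + y * Complex.I)‖ ≤ C * (1 + |y|) ^ (-ε) := by
  set ε := min δ 1 / 2 with hε
  have hε0 : 0 < ε := by positivity
  have hεδ : ε < δ := by
    have := min_le_left δ 1
    linarith
  have hε1 : ε < 1 := by
    have := min_le_right δ 1
    linarith
  obtain ⟨C, hC⟩ := exists_norm_betaIntegral_le (sub_pos.2 hc) hε0 hε1
  set M := ‖Complex.betaIntegral ((c - δ + ε : ℝ) : ℂ) ((δ - ε : ℝ) : ℂ)‖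
  have hC0 : 0 ≤ C := by simpa using (norm_nonneg _).trans (hC 0)
  refine ⟨C / ‖Complex.Gamma ε‖ * (M / ‖Complex.Gamma ((δ - ε : ℝ) : ℂ)‖), ε, by positivity, hε0,
    fun y => ?_⟩
  set s : ℂ := c + y * Complex.I with hs
  have hsre : s.re = c := by simp [hs]
  have hmid : Complex.Gamma (s - δ + ε) ≠ 0 :=
    Complex.Gamma_ne_zero_of_re_pos (by simp [hsre]; linarith)
  have h1 := Gamma_sub_div_Gamma (s := s - δ + ε) hε0 (by simp [hsre]; linarith)
  have h2 := Gamma_sub_div_Gamma (s := s) (δ := δ - ε) (by linarith) (by rw [hsre]; linarith)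
  rw [show s - ((δ - ε : ℝ) : ℂ) = s - δ + ε by push_cast; ring] at h2
  rw [add_sub_cancel_right] at h1
  rw [← div_mul_div_cancel₀ hmid, h1, h2, norm_mul, norm_div, norm_div]
  have b1 : ‖Complex.betaIntegral (s - δ) ε‖ ≤ C * (1 + |y|) ^ (-ε) := by
    have := hC y
    rwa [show ((c - δ : ℝ) : ℂ) + y * Complex.I = s - δ by rw [hs]; push_cast; ring] at this
  have b2 : ‖Complex.betaIntegral (s - δ + ε) ((δ - ε : ℝ) : ℂ)‖ ≤ M := by
    have hre : (s - δ + ε).re = c - δ + ε := by simp [hsre]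
    have := norm_betaIntegral_le_betaIntegral_re (u := s - δ + ε) (δ := δ - ε)
      (by rw [hre]; linarith) (by linarith)
    rwa [hre] at this
  calc _ ≤ C * (1 + |y|) ^ (-ε) / ‖Complex.Gamma ε‖ * (M / ‖Complex.Gamma ((δ - ε : ℝ) : ℂ)‖) := by
        gcongr
    _ = _ := by ring

theorem continuous_Gamma_vertical {a b : ℝ} (h : 0 < a + b) :
    Continuous fun y : ℝ => Complex.Gamma (a + y * Complex.I + b) := by
  refine continuous_iff_continuousAt.2 fun y => ?_
  refine ContinuousAt.comp (g := Complex.Gamma) (Complex.continuousAt_Gamma _ fun m hm => ?_)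
    (by fun_prop)
  have := congrArg Complex.re hm
  simp at this
  have hm0 : (0 : ℝ) ≤ m := m.cast_nonneg
  linarith

/-! ### The Meijer integrand on vertical lines -/

/-- The Mellin transform whose inverse is `𝒢_K`, up to the factor `Γ(δ + 1)^K`, is integrable on
vertical lines. -/
theorem integrable_Gamma_ratio_pow_div {K : ℕ} (hK : 1 ≤ K) {c δ : ℝ} (hδ : 0 < δ) (hc : δ < c) :
    Integrable fun y : ℝ => (Complex.Gamma (c + y * Complex.I - δ) /
      Complex.Gamma (c + y * Complex.I)) ^ K / (c + y * Complex.I) := by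
  obtain ⟨C, ε, hC, hε, hb⟩ := exists_norm_Gamma_div_Gamma_le hδ hc
  have hc0 : 0 < c := hδ.trans hc
  have hne (y : ℝ) : (c : ℂ) + y * Complex.I ≠ 0 := by
    intro h
    have := congrArg Complex.re h
    simp at this
    exact hc0.ne' this
  have hcont : Continuous fun y : ℝ => (Complex.Gamma (c + y * Complex.I - δ) /
      Complex.Gamma (c + y * Complex.I)) ^ K / (c + y * Complex.I) := by
    refine Continuous.div ((Continuous.div ?_ ?_ ?_).pow K) (by fun_prop) hne
    · simpa [sub_eq_add_neg] using continuous_Gamma_vertical (a := c) (b := -δ) (by linarith)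
    · simpa using continuous_Gamma_vertical (a := c) (b := 0) (by linarith)
    · exact fun y => Complex.Gamma_ne_zero_of_re_pos (by simpa)
  have hdom : Integrable fun y : ℝ => C ^ K * (1 / c + 1) * (1 + ‖y‖) ^ (-(1 + ε)) :=
    (integrable_one_add_norm (by simpa using hε)).const_mul _
  refine hdom.mono' hcont.aestronglyMeasurable (ae_of_all _ fun y => ?_)
  have hy1 : 1 ≤ 1 + |y| := by linarith [abs_nonneg y]
  have hn1 : c ≤ ‖(c : ℂ) + y * Complex.I‖ := by
    simpa [abs_of_pos hc0] using Complex.abs_re_le_norm ((c : ℂ) + y * Complex.I)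
  have hn2 : |y| ≤ ‖(c : ℂ) + y * Complex.I‖ := by
    simpa using Complex.abs_im_le_norm ((c : ℂ) + y * Complex.I)
  have hinv : ‖(c : ℂ) + y * Complex.I‖⁻¹ ≤ (1 / c + 1) * (1 + |y|)⁻¹ := by
    rw [← div_eq_mul_inv, inv_le_comm₀ (by linarith) (by positivity), inv_div,
      div_le_iff₀ (by positivity)]
    have : 1 ≤ ‖(c : ℂ) + y * Complex.I‖ * (1 / c) := by
      rwa [mul_one_div, one_le_div hc0]
    linarith
  rw [norm_div, norm_pow, div_eq_mul_inv]
  calc _ ≤ (C * (1 + |y|) ^ (-ε)) ^ K * ((1 / c + 1) * (1 + |y|)⁻¹) := by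
        gcongr
        exact hb y
    _ = C ^ K * (1 / c + 1) * (((1 + |y|) ^ (-ε)) ^ K * (1 + |y|)⁻¹) := by
        rw [mul_pow]; ring
    -- One of the `K` decaying factors is kept; with `1/s` it gives the integrable exponent `-(1 +
    -- ε)`.
    _ ≤ C ^ K * (1 / c + 1) * ((1 + |y|) ^ (-ε) * (1 + |y|)⁻¹) := by
        gcongr
        refine pow_le_of_le_one (by positivity) ?_ (by omega)
        exact Real.rpow_le_one_of_one_le_of_nonpos hy1 (by linarith)
    _ = _ := by
        rw [← Real.rpow_neg_one, ← Real.rpow_add (by linarith), Real.norm_eq_abs]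
        congr 2; ring

/-- The lower parameter 0 contributes `1/Γ(1 + s) = 1/(s Γ(s))`, which is the source of the lone
`1/s`; the other `K - 1` contribute `1/Γ(s)` each. -/
theorem meijerIntegrand_eq {K : ℕ} (hK : 1 ≤ K) {δ : ℝ} {z s : ℂ} (hs : 0 < s.re) :
    meijerIntegrand 0 K (upperParams K δ) (lowerParams K) z s =
      (Complex.Gamma (s - δ) / Complex.Gamma s) ^ K / s * z ^ s := by
  obtain ⟨n, rfl⟩ : ∃ n, K = n + 1 := ⟨K - 1, by omega⟩
  have hs0 : s ≠ 0 := by rintro rfl; simp at hs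
  have hG := Complex.Gamma_ne_zero_of_re_pos hs
  have h1 : (1 : ℂ) - (1 + δ) + s = s - δ := by ring
  simp only [meijerIntegrand, upperParams, lowerParams, not_lt_zero, if_false, Fin.is_lt, if_true,
    Finset.prod_const, Finset.card_univ, Fintype.card_fin, Fin.prod_univ_succ, Fin.val_zero,
    Fin.val_succ, Nat.add_eq_zero_iff, one_ne_zero, and_false, sub_self, sub_zero, zero_add, h1]
  rw [add_comm 1 s, Complex.Gamma_add_one s hs0, div_pow, inv_pow, pow_succ (Complex.Gamma s)]
  field_simp

theorem meijerLine_iff {K : ℕ} (hK : 1 ≤ K) {δ c : ℝ} :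
    MeijerLine 0 K (upperParams K δ) (lowerParams K) c ↔ δ < c := by
  simp only [MeijerLine, upperParams, not_lt_zero, false_imp_iff, implies_true, true_and,
    Fin.is_lt, true_imp_iff]
  refine ⟨fun h => by simpa using h ⟨0, hK⟩, fun h _ => by simpa using h⟩

/-! ### The limiting density and its Beta integral -/

/-- The limiting density `p t^(p-1)`, `t > 0`, of a rescaled envelope. -/
def radialDensity (p t : ℝ) : ℝ := (Set.Ioi 0).indicator (fun t => p * t ^ (p - 1)) t

theorem measurable_radialDensity (p : ℝ) : Measurable (radialDensity p) := by
  unfold radialDensity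
  exact Measurable.indicator (by fun_prop) measurableSet_Ioi

theorem radialDensity_nonneg {p : ℝ} (hp : 0 ≤ p) (t : ℝ) : 0 ≤ radialDensity p t :=
  Set.indicator_nonneg (fun _ ht => mul_nonneg hp (Real.rpow_nonneg (Set.mem_Ioi.1 ht).le _)) t

theorem image_inv_one_add_sq : (fun t : ℝ => (1 + t ^ 2)⁻¹) '' Set.Ioi 0 = Set.Ioo 0 1 := by
  ext x
  simp only [Set.mem_image, Set.mem_Ioi, Set.mem_Ioo]
  constructor
  · rintro ⟨t, ht, rfl⟩
    have : 0 < t ^ 2 := by positivity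
    exact ⟨by positivity, inv_lt_one_of_one_lt₀ (by linarith)⟩
  · rintro ⟨h0, h1⟩
    have h2 : 1 < x⁻¹ := (one_lt_inv₀ h0).2 h1
    refine ⟨√(x⁻¹ - 1), Real.sqrt_pos.2 (by linarith), ?_⟩
    rw [Real.sq_sqrt (by linarith)]
    simp

/-- Pointwise form of the substitution `x = 1/(1 + t²)`, which carries the Beta integrand to the
radial one. -/
theorem radialDensity_mul_cpow_aux {δ t : ℝ} (ht : 0 < t) (s : ℂ) :
    (δ : ℂ) * (|-(2 * t) / (1 + t ^ 2) ^ 2| • ((((1 + t ^ 2)⁻¹ : ℝ) : ℂ) ^ (s - δ - 1) *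
      (1 - (((1 + t ^ 2)⁻¹ : ℝ) : ℂ)) ^ ((δ : ℂ) - 1))) =
    ((2 * δ * t ^ (2 * δ - 1) : ℝ) : ℂ) * ((1 + t ^ 2 : ℝ) : ℂ) ^ (-s) := by
  set q : ℝ := 1 + t ^ 2 with hq
  have hq0 : 0 < q := by positivity
  have hqc : (q : ℂ) ≠ 0 := by exact_mod_cast hq0.ne'
  have h1 : (1 : ℂ) - ((q⁻¹ : ℝ) : ℂ) = ((t ^ 2 * q⁻¹ : ℝ) : ℂ) := by
    rw [← Complex.ofReal_one, ← Complex.ofReal_sub]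
    congr 1
    field_simp
    rw [hq]; ring
  have habs : |-(2 * t) / q ^ 2| = 2 * t * (q ^ 2)⁻¹ := by
    rw [abs_div, abs_neg, abs_of_pos (by positivity), abs_of_pos (by positivity), div_eq_mul_inv]
  have harg : (q : ℂ).arg ≠ Real.pi := by
    rw [Complex.arg_ofReal_of_nonneg hq0.le]; exact Real.pi_pos.ne
  have h2 : ((t ^ 2 : ℝ) : ℂ) ^ ((δ : ℂ) - 1) = ((t ^ (2 * δ - 2) : ℝ) : ℂ) := by
    rw [← Complex.ofReal_one, ← Complex.ofReal_sub, ← Complex.ofReal_cpow (by positivity),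
      ← Real.rpow_natCast, ← Real.rpow_mul ht.le]
    congr 2; push_cast; ring
  have h3 : t ^ (2 * δ - 1) = t ^ (2 * δ - 2) * t := by
    rw [← Real.rpow_add_one ht.ne']; congr 1; ring
  have h4 : (q : ℂ) ^ (-s) = (q : ℂ) ^ (-(s - δ - 1)) * (q : ℂ) ^ (-((δ : ℂ) - 1)) * ((q : ℂ) ^ 2)⁻¹ := by
    rw [← Complex.cpow_ofNat, ← Complex.cpow_neg, ← Complex.cpow_add _ _ hqc,
      ← Complex.cpow_add _ _ hqc]
    congr 1; ring
  rw [h1, Complex.ofReal_mul (t ^ 2), Complex.mul_cpow_ofReal_nonneg (by positivity) (by positivity),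
    h2, Complex.ofReal_inv, Complex.inv_cpow _ _ harg, Complex.inv_cpow _ _ harg,
    ← Complex.cpow_neg, ← Complex.cpow_neg, habs, h3, h4, Complex.real_smul]
  push_cast
  ring

/-- `∫₀^∞ p t^(p-1) (1 + t²)^(-s) dt = Γ(p/2 + 1) Γ(s - p/2) / Γ(s)`. -/
theorem integral_radialDensity_mul_cpow {p : ℝ} (hp : 0 < p) {s : ℂ} (hs : p / 2 < s.re) :
    Integrable (fun t : ℝ => (radialDensity p t : ℂ) * ((1 + t ^ 2 : ℝ) : ℂ) ^ (-s)) ∧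
    ∫ t : ℝ, (radialDensity p t : ℂ) * ((1 + t ^ 2 : ℝ) : ℂ) ^ (-s) =
      Real.Gamma (p / 2 + 1) * (Complex.Gamma (s - (p / 2 : ℝ)) / Complex.Gamma s) := by
  obtain ⟨δ, rfl⟩ : ∃ δ, p = 2 * δ := ⟨p / 2, by ring⟩
  rw [mul_div_cancel_left₀ δ two_ne_zero] at hs ⊢
  have hδ : 0 < δ := by linarith
  have hind : (fun t : ℝ => (radialDensity (2 * δ) t : ℂ) * ((1 + t ^ 2 : ℝ) : ℂ) ^ (-s)) =
      (Set.Ioi 0).indicator fun t : ℝ =>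
        ((2 * δ * t ^ (2 * δ - 1) : ℝ) : ℂ) * ((1 + t ^ 2 : ℝ) : ℂ) ^ (-s) := by
    ext t
    by_cases ht : t ∈ Set.Ioi (0 : ℝ) <;> simp [radialDensity, ht]
  have hderiv (t : ℝ) : HasDerivWithinAt (fun t : ℝ => (1 + t ^ 2)⁻¹) (-(2 * t) / (1 + t ^ 2) ^ 2)
      (Set.Ioi 0) t := by
    have h1 : HasDerivAt (fun t : ℝ => 1 + t ^ 2) (2 * t) t := by
      simpa using (hasDerivAt_pow 2 t).const_add 1
    exact (h1.fun_inv (by positivity)).hasDerivWithinAt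
  have hinj : Set.InjOn (fun t : ℝ => (1 + t ^ 2)⁻¹) (Set.Ioi 0) := by
    intro x hx y hy h
    simp only [inv_inj, add_right_inj] at h
    exact (sq_eq_sq₀ (Set.mem_Ioi.1 hx).le (Set.mem_Ioi.1 hy).le).1 h
  set B : ℝ → ℂ := fun x => (x : ℂ) ^ (s - δ - 1) * (1 - (x : ℂ)) ^ ((δ : ℂ) - 1) with hB
  have hBint : IntegrableOn B (Set.Ioo 0 1) :=
    ((intervalIntegrable_iff_integrableOn_Ioo_of_le zero_le_one).1
      (Complex.betaIntegral_convergent (u := s - δ) (v := δ) (by simpa) (by simpa)))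
  have hsub := integral_image_eq_integral_abs_deriv_smul measurableSet_Ioi
    (fun t _ => hderiv t) hinj B
  have hsubi := integrableOn_image_iff_integrableOn_abs_deriv_smul measurableSet_Ioi
    (fun t _ => hderiv t) hinj B
  rw [image_inv_one_add_sq] at hsub hsubi
  have hI := (hsubi.1 hBint).const_mul (δ : ℂ)
  have hcongr : Set.EqOn
      (fun t : ℝ => (δ : ℂ) * (|-(2 * t) / (1 + t ^ 2) ^ 2| • B (1 + t ^ 2)⁻¹))
      (fun t : ℝ => ((2 * δ * t ^ (2 * δ - 1) : ℝ) : ℂ) * ((1 + t ^ 2 : ℝ) : ℂ) ^ (-s))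
      (Set.Ioi 0) := fun t ht => radialDensity_mul_cpow_aux ht s
  rw [hind, integrable_indicator_iff measurableSet_Ioi, integral_indicator measurableSet_Ioi]
  refine ⟨IntegrableOn.congr_fun hI hcongr measurableSet_Ioi, ?_⟩
  rw [← setIntegral_congr_fun measurableSet_Ioi hcongr, integral_const_mul, ← hsub,
    ← integral_Ioc_eq_integral_Ioo, ← intervalIntegral.integral_of_le zero_le_one,
    Gamma_sub_div_Gamma hδ hs, Real.Gamma_add_one hδ.ne']
  have h0 : Complex.Gamma δ ≠ 0 := Complex.Gamma_ne_zero_of_re_pos (by simpa)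
  rw [hB, ← Complex.betaIntegral]
  push_cast
  rw [Complex.Gamma_ofReal] at h0 ⊢
  field_simp

/-! ### The outage region and its volume -/

/-- The sublevel set `∏ₖ (1 + tₖ²) < z` on which the rescaled channel is in outage. -/
def outageRegion (K : ℕ) (z : ℝ) : Set (Fin K → ℝ) := {t | ∏ k, (1 + t k ^ 2) < z}

/-- The mass of the outage region under the limiting product density. -/
def outageVolume (p : ℝ) (K : ℕ) (z : ℝ) : ℝ :=
  ∫ t in outageRegion K z, ∏ k, radialDensity p (t k)

theorem isOpen_outageRegion (K : ℕ) (z : ℝ) : IsOpen (outageRegion K z) :=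
  isOpen_lt (by fun_prop) continuous_const

theorem one_le_prod_one_add_sq {K : ℕ} (t : Fin K → ℝ) : 1 ≤ ∏ k, (1 + t k ^ 2) := by
  have := Finset.prod_le_prod (s := Finset.univ) (f := fun _ : Fin K => (1 : ℝ))
    (g := fun k => 1 + t k ^ 2) (fun _ _ => zero_le_one) (fun k _ => by nlinarith [sq_nonneg (t k)])
  simpa using this

theorem le_sqrt_of_mem_outageRegion {K : ℕ} {z : ℝ} {t : Fin K → ℝ} (ht : t ∈ outageRegion K z)
    (k : Fin K) : t k ≤ √z := by
  have h1 : 1 + t k ^ 2 ≤ ∏ k, (1 + t k ^ 2) := by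
    rw [← Finset.mul_prod_erase _ _ (Finset.mem_univ k)]
    refine le_mul_of_one_le_right (by positivity) ?_
    have := Finset.prod_le_prod (s := Finset.univ.erase k) (f := fun _ : Fin K => (1 : ℝ))
      (g := fun k => 1 + t k ^ 2) (fun _ _ => zero_le_one)
      (fun k _ => by nlinarith [sq_nonneg (t k)])
    simpa using this
  have h2 : ∏ k, (1 + t k ^ 2) < z := ht
  exact Real.le_sqrt_of_sq_le (by linarith)

/-- Truncation of the limiting density to a bounded interval. -/
def truncatedRadialDensity (p b t : ℝ) : ℝ := (Set.Iic b).indicator (radialDensity p) t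

theorem integrable_truncatedRadialDensity {p : ℝ} (hp : 0 < p) (b : ℝ) :
    Integrable (truncatedRadialDensity p b) := by
  have h : truncatedRadialDensity p b = (Set.Ioc 0 b).indicator fun t => p * t ^ (p - 1) := by
    ext t
    by_cases h1 : t ≤ b <;> by_cases h2 : 0 < t <;>
      simp [truncatedRadialDensity, radialDensity, h1, h2]
  rw [h, integrable_indicator_iff measurableSet_Ioc]
  refine Integrable.const_mul ?_ p
  rcases le_total 0 b with hb | hb
  · exact (intervalIntegrable_iff_integrableOn_Ioc_of_le hb).1
      (intervalIntegral.intervalIntegrable_rpow' (by linarith))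
  · simp [Set.Ioc_eq_empty (not_lt.2 hb)]

/-- The radial density has infinite mass, but points of the region have coordinates at most `√z`. On
the region it may be replaced by its truncation, whose product is integrable and serves as
dominating function. -/
theorem prod_radialDensity_eq_truncated {p : ℝ} {K : ℕ} {z b : ℝ} {t : Fin K → ℝ} (hzb : √z ≤ b)
    (ht : t ∈ outageRegion K z) :
    ∏ k, radialDensity p (t k) = ∏ k, truncatedRadialDensity p b (t k) := by
  refine Finset.prod_congr rfl fun k _ => ?_
  rw [truncatedRadialDensity, Set.indicator_of_mem]
  exact (le_sqrt_of_mem_outageRegion ht k).trans hzb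

theorem truncatedRadialDensity_nonneg {p : ℝ} (hp : 0 ≤ p) (b t : ℝ) :
    0 ≤ truncatedRadialDensity p b t :=
  Set.indicator_nonneg (fun _ _ => radialDensity_nonneg hp _) t

theorem measurable_prod_radialDensity (p : ℝ) (K : ℕ) :
    Measurable fun t : Fin K → ℝ => ∏ k, radialDensity p (t k) :=
  Finset.measurable_prod _ fun k _ => (measurable_radialDensity p).comp (measurable_pi_apply k)

theorem integrable_prod_truncatedRadialDensity {p : ℝ} (hp : 0 < p) (K : ℕ) (b : ℝ) :
    Integrable fun t : Fin K → ℝ => ∏ k, truncatedRadialDensity p b (t k) :=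
  Integrable.fintype_prod (f := fun _ => truncatedRadialDensity p b) fun _ =>
    integrable_truncatedRadialDensity hp b

/-- Once the other coordinates are fixed, the first can take at most the two values `±√(z / ∏ - 1)`;
Fubini concludes. -/
theorem volume_prod_one_add_sq_eq {K : ℕ} (hK : 1 ≤ K) (z : ℝ) :
    volume {t : Fin K → ℝ | ∏ k, (1 + t k ^ 2) = z} = 0 := by
  obtain ⟨n, rfl⟩ : ∃ n, K = n + 1 := ⟨K - 1, by omega⟩
  have hm : MeasurableSet {t : Fin (n + 1) → ℝ | ∏ k, (1 + t k ^ 2) = z} :=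
    measurableSet_eq_fun (by fun_prop) measurable_const
  have hmp := (volume_preserving_piFinSuccAbove (fun _ : Fin (n + 1) => ℝ) 0).symm
  rw [← hmp.measure_preimage_equiv, Measure.volume_eq_prod,
    Measure.prod_apply_symm (hmp.measurable hm)]
  refine (lintegral_congr fun y => ?_).trans lintegral_zero
  refine Set.Finite.measure_zero (Set.Finite.subset
    (Set.toFinite {√(z / (∏ k, (1 + y k ^ 2)) - 1), -√(z / (∏ k, (1 + y k ^ 2)) - 1)}) ?_) _
  intro x hx
  simp only [Set.mem_preimage, Set.mem_ofPred_eq, MeasurableEquiv.piFinSuccAbove_symm_apply,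
    Fin.insertNthEquiv, Fin.prod_univ_succ, Fin.insertNth_zero, Equiv.coe_fn_mk, Fin.cons_succ,
    Fin.cons_zero, cast_eq] at hx
  have hy := one_le_prod_one_add_sq y
  have hx2 : z / (∏ k, (1 + y k ^ 2)) - 1 = x ^ 2 := by
    rw [← hx, mul_div_cancel_right₀ _ (by linarith)]; ring
  rw [hx2, Real.sqrt_sq_eq_abs]
  rcases abs_choice x with h | h <;> simp [h]

theorem outageVolume_eq_integral_indicator (p : ℝ) (K : ℕ) (z : ℝ) :
    outageVolume p K z =
      ∫ t, (outageRegion K z).indicator (fun t => ∏ k, radialDensity p (t k)) t := by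
  rw [outageVolume, integral_indicator (isOpen_outageRegion K z).measurableSet]

/-- Off the null level set `∏ (1 + tₖ²) = z`, the indicator of the region is locally constant in
`z`, so dominated convergence applies. -/
theorem continuousAt_outageVolume {p : ℝ} (hp : 0 < p) {K : ℕ} (hK : 1 ≤ K) (z : ℝ) :
    ContinuousAt (outageVolume p K) z := by
  have heq : outageVolume p K = fun z =>
      ∫ t, (outageRegion K z).indicator (fun t => ∏ k, radialDensity p (t k)) t :=
    funext fun z => outageVolume_eq_integral_indicator p K z
  rw [heq]
  refine continuousAt_of_dominated
    (bound := fun t => ∏ k, truncatedRadialDensity p √(z + 1) (t k)) ?_ ?_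
    (integrable_prod_truncatedRadialDensity hp K _) ?_
  · exact Eventually.of_forall fun z => ((measurable_prod_radialDensity p K).indicator
      (isOpen_outageRegion K z).measurableSet).aestronglyMeasurable
  · filter_upwards [Iio_mem_nhds (lt_add_one z)] with w hw
    refine ae_of_all _ fun t => ?_
    have h0 : 0 ≤ ∏ k, truncatedRadialDensity p √(z + 1) (t k) :=
      Finset.prod_nonneg fun k _ => truncatedRadialDensity_nonneg hp.le _ _
    by_cases ht : t ∈ outageRegion K w
    · rw [Set.indicator_of_mem ht, prod_radialDensity_eq_truncated
        (Real.sqrt_le_sqrt (Set.mem_Iio.1 hw).le) ht, Real.norm_of_nonneg h0]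
    · rw [Set.indicator_of_notMem ht, norm_zero]; exact h0
  · have : ∀ᵐ t : Fin K → ℝ, ∏ k, (1 + t k ^ 2) ≠ z := by
      rw [ae_iff]; simpa using volume_prod_one_add_sq_eq hK z
    filter_upwards [this] with t ht
    rcases lt_or_gt_of_ne ht with h | h
    · refine (continuousAt_const (y := ∏ k, radialDensity p (t k))).congr ?_
      filter_upwards [Ioi_mem_nhds h] with w hw
      rw [Set.indicator_of_mem (show t ∈ outageRegion K w from hw)]
    · refine (continuousAt_const (y := (0 : ℝ))).congr ?_
      filter_upwards [Iio_mem_nhds h] with w hw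
      rw [Set.indicator_of_notMem]
      exact not_lt.2 (Set.mem_Iio.1 hw).le

/-- The density is positive on the open part of the region in the positive orthant, which contains a
small diagonal point because `z > 1`. -/
theorem outageVolume_pos {p : ℝ} (hp : 0 < p) (K : ℕ) {z : ℝ} (hz : 1 < z) :
    0 < outageVolume p K z := by
  have hmeas := (isOpen_outageRegion K z).measurableSet
  have hint : IntegrableOn (fun t : Fin K → ℝ => ∏ k, radialDensity p (t k)) (outageRegion K z) :=
    (integrable_prod_truncatedRadialDensity hp K √z).integrableOn.congr_fun
      (fun t ht => (prod_radialDensity_eq_truncated le_rfl ht).symm) hmeas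
  rw [outageVolume, setIntegral_pos_iff_support_of_nonneg_ae
    (ae_of_all _ fun t => Finset.prod_nonneg fun k _ => radialDensity_nonneg hp.le _) hint]
  have hopen : IsOpen (Set.univ.pi (fun _ : Fin K => Set.Ioi (0 : ℝ)) ∩ outageRegion K z) :=
    (isOpen_set_pi Set.finite_univ fun _ _ => isOpen_Ioi).inter (isOpen_outageRegion K z)
  refine (hopen.measure_pos volume ?_).trans_le (measure_mono ?_)
  · have hc : Tendsto (fun ε : ℝ => ∏ _k : Fin K, (1 + ε ^ 2)) (𝓝[>] 0) (𝓝 1) := by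
      have : Continuous fun ε : ℝ => ∏ _k : Fin K, (1 + ε ^ 2) := by fun_prop
      simpa using (this.tendsto 0).mono_left nhdsWithin_le_nhds
    obtain ⟨ε, h1, h2⟩ := ((hc.eventually (gt_mem_nhds hz)).and self_mem_nhdsWithin).exists
    exact ⟨fun _ => ε, fun _ _ => h2, h1⟩
  · rintro t ⟨ht1, ht2⟩
    refine ⟨?_, ht2⟩
    rw [Function.mem_support]
    refine Finset.prod_ne_zero_iff.2 fun k _ => ?_
    have hk : t k ∈ Set.Ioi (0 : ℝ) := ht1 k trivial
    rw [radialDensity, Set.indicator_of_mem hk]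
    exact (mul_pos hp (Real.rpow_pos_of_pos hk _)).ne'

/-! ### Mellin transform of the outage volume and its inversion -/

/-- The inner integral of the Fubini argument, over `0 < x < 1/q`: the integrability and norm
clauses justify the swap, the value clause evaluates it. -/
theorem integral_cpow_indicator_mul_lt_one {q : ℝ} (hq : 0 < q) {s : ℂ} (hs : 0 < s.re) :
    IntegrableOn ({x : ℝ | x * q < 1}.indicator fun x : ℝ => (x : ℂ) ^ (s - 1)) (Set.Ioi 0) ∧
    ∫ x in Set.Ioi 0, {x : ℝ | x * q < 1}.indicator (fun x : ℝ => (x : ℂ) ^ (s - 1)) x =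
      (q : ℂ) ^ (-s) / s ∧
    ∫ x in Set.Ioi 0, ‖{x : ℝ | x * q < 1}.indicator (fun x : ℝ => (x : ℂ) ^ (s - 1)) x‖ =
      q ^ (-s.re) / s.re := by
  have hset : {x : ℝ | x * q < 1} = Set.Iio q⁻¹ := by
    ext x; simp [← lt_div_iff₀ hq]
  have hs0 : s ≠ 0 := by rintro rfl; simp at hs
  have hq' : (0 : ℝ) ≤ q⁻¹ := by positivity
  have harg : (q : ℂ).arg ≠ Real.pi := by
    rw [Complex.arg_ofReal_of_nonneg hq.le]; exact Real.pi_pos.ne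
  have hI := (intervalIntegrable_iff_integrableOn_Ioo_of_le hq').1
    (intervalIntegral.intervalIntegrable_cpow' (r := s - 1) (a := 0) (b := q⁻¹) (by simpa using hs))
  rw [hset]
  refine ⟨?_, ?_, ?_⟩
  · rw [IntegrableOn, integrable_indicator_iff measurableSet_Iio, IntegrableOn,
      Measure.restrict_restrict measurableSet_Iio, Set.Iio_inter_Ioi]
    exact hI
  · rw [setIntegral_indicator measurableSet_Iio, Set.Ioi_inter_Iio, ← integral_Ioc_eq_integral_Ioo,
      ← intervalIntegral.integral_of_le hq', integral_cpow (Or.inl (by simpa using hs)),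
      sub_add_cancel, Complex.ofReal_zero, Complex.zero_cpow hs0, sub_zero, Complex.ofReal_inv,
      Complex.inv_cpow _ _ harg, Complex.cpow_neg]
  · simp_rw [norm_indicator_eq_indicator_norm]
    rw [setIntegral_indicator measurableSet_Iio, Set.Ioi_inter_Iio]
    have hcongr : Set.EqOn (fun x : ℝ => ‖(x : ℂ) ^ (s - 1)‖) (fun x => x ^ (s.re - 1))
        (Set.Ioo 0 q⁻¹) := fun x hx => by
      simp [Complex.norm_cpow_eq_rpow_re_of_pos hx.1]
    rw [setIntegral_congr_fun measurableSet_Ioo hcongr, ← integral_Ioc_eq_integral_Ioo,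
      ← intervalIntegral.integral_of_le hq', integral_rpow (Or.inl (by linarith)),
      sub_add_cancel, Real.zero_rpow hs.ne', sub_zero, Real.inv_rpow hq.le, Real.rpow_neg hq.le]

theorem prod_ofReal_cpow {K : ℕ} {x : Fin K → ℝ} (hx : ∀ k, 0 ≤ x k) (s : ℂ) :
    ((∏ k, x k : ℝ) : ℂ) ^ s = ∏ k, (x k : ℂ) ^ s := by
  induction K with
  | zero => simp
  | succ n ih =>
    rw [Fin.prod_univ_succ, Fin.prod_univ_succ, Complex.ofReal_mul,
      Complex.mul_cpow_ofReal_nonneg (hx 0) (Finset.prod_nonneg fun k _ => hx _),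
      ih fun k => hx k.succ]

/-- The Mellin transform of the outage volume. -/
theorem mellin_outageVolume_inv {p : ℝ} (hp : 0 < p) (K : ℕ) {s : ℂ} (hs : p / 2 < s.re) :
    MellinConvergent (fun x => (outageVolume p K x⁻¹ : ℂ)) s ∧
    mellin (fun x => (outageVolume p K x⁻¹ : ℂ)) s = (Real.Gamma (p / 2 + 1) : ℂ) ^ K *
      ((Complex.Gamma (s - (p / 2 : ℝ)) / Complex.Gamma s) ^ K / s) := by
  have hs0 : 0 < s.re := by linarith
  set g : (Fin K → ℝ) → ℂ := fun t => ((∏ k, radialDensity p (t k) : ℝ) : ℂ) with hg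
  set Q : (Fin K → ℝ) → ℝ := fun t => ∏ k, (1 + t k ^ 2) with hQ
  have hQ0 (t) : 0 < Q t := zero_lt_one.trans_le (one_le_prod_one_add_sq t)
  -- For `x > 0`, `x * Q t < 1` says that `t` lies in the outage region of `x⁻¹`. Integrating `F`
  -- over `t` first gives the Mellin integrand; over `x` first, a product of one-dimensional
  -- integrals.
  set F : ℝ × (Fin K → ℝ) → ℂ :=
    {a | a.1 * Q a.2 < 1}.indicator fun a => (a.1 : ℂ) ^ (s - 1) * g a.2 with hF
  obtain ⟨hI, hIval⟩ := integral_radialDensity_mul_cpow hp hs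
  have hprod (t : Fin K → ℝ) : g t * (Q t : ℂ) ^ (-s) =
      ∏ k, ((radialDensity p (t k) : ℂ) * ((1 + t k ^ 2 : ℝ) : ℂ) ^ (-s)) := by
    rw [Finset.prod_mul_distrib, hQ, prod_ofReal_cpow (fun k => by positivity)]
    simp only [hg, Complex.ofReal_prod]
  have hgQ : Integrable fun t => g t * (Q t : ℂ) ^ (-s) := by
    simp_rw [hprod]
    exact Integrable.fintype_prod
      (f := fun _ t => (radialDensity p t : ℂ) * ((1 + t ^ 2 : ℝ) : ℂ) ^ (-s)) fun _ => hI
  have hgmeas : Measurable g := Complex.measurable_ofReal.comp (measurable_prod_radialDensity p K)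
  have hQmeas : Measurable Q := by fun_prop
  have hFmeas : Measurable F := by
    refine Measurable.indicator (by fun_prop) ?_
    exact measurableSet_lt (by fun_prop) measurable_const
  have hFx (x : ℝ) (t) : F (x, t) =
      {x : ℝ | x * Q t < 1}.indicator (fun x : ℝ => (x : ℂ) ^ (s - 1)) x * g t := by
    simp [hF, Set.indicator_apply]
  have hFint : Integrable F ((volume.restrict (Set.Ioi 0)).prod volume) := by
    rw [integrable_prod_iff' hFmeas.aestronglyMeasurable]
    refine ⟨ae_of_all _ fun t => ?_, ?_⟩
    · simp_rw [hFx]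
      exact (integral_cpow_indicator_mul_lt_one (hQ0 t) hs0).1.mul_const _
    · have : (fun t => ∫ x in Set.Ioi 0, ‖F (x, t)‖) =
          fun t => ‖g t * (Q t : ℂ) ^ (-s)‖ / s.re := by
        ext t
        simp_rw [hFx, norm_mul]
        rw [integral_mul_const, (integral_cpow_indicator_mul_lt_one (hQ0 t) hs0).2.2,
          Complex.norm_cpow_eq_rpow_re_of_pos (hQ0 t), Complex.neg_re]
        ring
      rw [this]
      exact hgQ.norm.div_const _
  have hinner : Set.EqOn (fun x : ℝ => ∫ t, F (x, t))
      (fun x : ℝ => (x : ℂ) ^ (s - 1) • (outageVolume p K x⁻¹ : ℂ)) (Set.Ioi 0) := by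
    intro x hx
    have hx0 : 0 < x := hx
    simp only
    rw [outageVolume_eq_integral_indicator, ← integral_complex_ofReal, smul_eq_mul,
      ← integral_const_mul]
    refine integral_congr_ae (ae_of_all _ fun t => ?_)
    have hiff : x * Q t < 1 ↔ t ∈ outageRegion K x⁻¹ := by
      rw [← lt_inv_mul_iff₀ hx0, mul_one]; rfl
    by_cases h : t ∈ outageRegion K x⁻¹
    · simp only [hFx, Set.indicator_of_mem h,
        Set.indicator_of_mem (show x ∈ {x : ℝ | x * Q t < 1} from hiff.2 h), hg]
    · simp only [hFx, Set.indicator_of_notMem h,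
        Set.indicator_of_notMem (show x ∉ {x : ℝ | x * Q t < 1} from mt hiff.1 h), zero_mul,
        Complex.ofReal_zero, mul_zero]
  refine ⟨IntegrableOn.congr_fun hFint.integral_prod_left hinner measurableSet_Ioi, ?_⟩
  rw [mellin, ← setIntegral_congr_fun measurableSet_Ioi hinner]
  rw [integral_integral_swap (f := fun x t => F (x, t)) hFint]
  have : (fun t => ∫ x in Set.Ioi 0, F (x, t)) = fun t => (g t * (Q t : ℂ) ^ (-s)) / s := by
    ext t
    simp_rw [hFx]
    rw [integral_mul_const, (integral_cpow_indicator_mul_lt_one (hQ0 t) hs0).2.1]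
    ring
  rw [this, integral_div]
  simp_rw [hprod]
  rw [integral_fintype_prod_volume_eq_pow
    (fun t : ℝ => (radialDensity p t : ℂ) * ((1 + t ^ 2 : ℝ) : ℂ) ^ (-s)), hIval, Fintype.card_fin,
    mul_pow]
  ring

/-- The Mellin–Barnes integral computes the outage volume. -/
theorem meijerLineIntegral_eq {K : ℕ} (hK : 1 ≤ K) {δ : ℝ} (hδ : 0 < δ) {z : ℝ} (hz : 0 < z)
    {c : ℝ} (hc : δ < c) :
    Integrable (fun y : ℝ => meijerIntegrand 0 K (upperParams K δ) (lowerParams K) z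
      (c + y * Complex.I)) ∧
    meijerLineIntegral 0 K (upperParams K δ) (lowerParams K) z c =
      ((outageVolume (2 * δ) K z / Real.Gamma (δ + 1) ^ K : ℝ) : ℂ) := by
  have hc0 : 0 < c := hδ.trans hc
  have hzc : (z : ℂ) ≠ 0 := by exact_mod_cast hz.ne'
  have hre (y : ℝ) : ((c : ℂ) + y * Complex.I).re = c := by simp
  have hG := integrable_Gamma_ratio_pow_div hK hδ hc
  have hmi (y : ℝ) := meijerIntegrand_eq (δ := δ) (z := z) hK (s := c + y * Complex.I) (by simpa)
  have hΓ : (Real.Gamma (δ + 1) : ℂ) ≠ 0 := by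
    exact_mod_cast (Real.Gamma_pos_of_pos (by linarith)).ne'
  have hmel (y : ℝ) := (mellin_outageVolume_inv (p := 2 * δ) (by linarith) K
    (s := c + y * Complex.I) (by simpa)).2
  simp only [mul_div_cancel_left₀ δ (two_ne_zero' ℝ)] at hmel
  simp only [meijerLineIntegral, hmi]
  constructor
  · refine hG.mul_bdd (c := z ^ c) ?_ (ae_of_all _ fun y => ?_)
    · refine Continuous.aestronglyMeasurable ?_
      exact Continuous.const_cpow (by fun_prop) (Or.inl hzc)
    · rw [Complex.norm_cpow_eq_rpow_re_of_pos hz, hre]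
  · have hinv := mellinInv_mellin_eq c (fun x => (outageVolume (2 * δ) K x⁻¹ : ℂ))
      (x := z⁻¹) (by positivity)
      (mellin_outageVolume_inv (by linarith) K (by simpa using hc)).1
      (by
        simp only [Complex.VerticalIntegrable, hmel]
        exact hG.const_mul _)
      (by
        refine Complex.continuous_ofReal.continuousAt.comp (ContinuousAt.comp
          (g := outageVolume (2 * δ) K) ?_ (continuousAt_inv₀ (by positivity)))
        rw [inv_inv]
        exact continuousAt_outageVolume (by linarith) hK z)
    have harg : (z : ℂ).arg ≠ Real.pi := by
      rw [Complex.arg_ofReal_of_nonneg hz.le]; exact Real.pi_pos.ne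
    simp only [mellinInv, hmel, inv_inv, smul_eq_mul] at hinv
    rw [Complex.ofReal_div, ← hinv, eq_div_iff (by exact_mod_cast pow_ne_zero K hΓ)]
    rw [mul_assoc, ← integral_mul_const, Complex.ofReal_pow, Complex.real_smul]
    congr 1
    · push_cast; rfl
    refine integral_congr_ae (ae_of_all _ fun y => ?_)
    simp only
    rw [Complex.ofReal_inv, Complex.inv_cpow _ _ harg, Complex.cpow_neg, inv_inv]
    ring

/-- Every admissible line yields the same volume, so the line chosen in `meijerG` is immaterial and
no contour shift is needed. -/
theorem meijerGConverges_and_codingG_eq {K : ℕ} (hK : 1 ≤ K) {δ : ℝ} (hδ : 0 < δ) (R : ℝ) :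
    MeijerGConverges 0 K (upperParams K δ) (lowerParams K) (((2 : ℝ) ^ R : ℝ) : ℂ) ∧
    codingG K δ R = ((outageVolume (2 * δ) K (2 ^ R) / Real.Gamma (δ + 1) ^ K : ℝ) : ℂ) := by
  have hz : (0 : ℝ) < 2 ^ R := by positivity
  have hex : ∃ c, MeijerLine 0 K (upperParams K δ) (lowerParams K) c :=
    ⟨δ + 1, (meijerLine_iff hK).2 (lt_add_one δ)⟩
  have hG : codingG K δ R =
      ((outageVolume (2 * δ) K (2 ^ R) / Real.Gamma (δ + 1) ^ K : ℝ) : ℂ) := by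
    rw [codingG, meijerG, dif_pos hex]
    exact (meijerLineIntegral_eq hK hδ hz ((meijerLine_iff hK).1 hex.choose_spec)).2
  refine ⟨⟨hex, fun c hc => ?_⟩, hG⟩
  have h := meijerLineIntegral_eq hK hδ hz ((meijerLine_iff hK).1 hc)
  exact ⟨h.1, h.2.trans hG.symm⟩

/-! ### Rescaled independent envelopes and the high-SNR limit -/

theorem map_mul_left_withDensity {b : ℝ} (hb : 0 < b) (f : ℝ → ENNReal) :
    Measure.map (fun x => b * x) (volume.withDensity f) =
      volume.withDensity fun t => ENNReal.ofReal b⁻¹ * f (b⁻¹ * t) := by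
  have hme : MeasurableEmbedding fun x : ℝ => b * x :=
    (Homeomorph.mulLeft₀ b hb.ne').measurableEmbedding
  ext s hs
  rw [hme.map_apply, withDensity_apply _ (hme.measurable hs), withDensity_apply _ hs]
  have h1 : (∫⁻ x in (fun x => b * x) ⁻¹' s, f x) =
      ∫⁻ t in s, f (b⁻¹ * t) ∂(Measure.map (fun x => b * x) volume) := by
    rw [hme.restrict_map, hme.lintegral_map]
    simp [inv_mul_cancel_left₀ hb.ne']
  rw [h1, Real.map_volume_mul_left hb.ne', abs_of_pos (by positivity), Measure.restrict_smul,
    lintegral_smul_measure, lintegral_const_mul' _ _ ENNReal.ofReal_ne_top, smul_eq_mul]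

theorem pi_withDensity_ofReal {ι : Type*} [Fintype ι] {g : ι → ℝ → ℝ} (hg : ∀ i, Integrable (g i))
    (hg0 : ∀ i t, 0 ≤ g i t) :
    Measure.pi (fun i => volume.withDensity fun t => ENNReal.ofReal (g i t)) =
      volume.withDensity fun t : ι → ℝ => ENNReal.ofReal (∏ i, g i (t i)) := by
  refine Measure.pi_eq fun s hs => ?_
  rw [withDensity_apply _ (MeasurableSet.univ_pi hs), volume_pi, Measure.restrict_pi_pi,
    ← ofReal_integral_eq_lintegral_ofReal
      (Integrable.fintype_prod fun i => (hg i).restrict)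
      (ae_of_all _ fun t => Finset.prod_nonneg fun i _ => hg0 i _),
    integral_fintype_prod_eq_prod,
    ENNReal.ofReal_prod_of_nonneg fun i _ => integral_nonneg (hg0 i)]
  refine Finset.prod_congr rfl fun i _ => ?_
  rw [withDensity_apply _ (hs i),
    ofReal_integral_eq_lintegral_ofReal (hg i).restrict (ae_of_all _ (hg0 i))]

theorem radialDensity_inv_mul {b : ℝ} (hb : 0 < b) (p t : ℝ) :
    b⁻¹ * radialDensity p (b⁻¹ * t) = b ^ (-p) * radialDensity p t := by
  have hb' : 0 < b⁻¹ := inv_pos.2 hb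
  by_cases ht : 0 < t
  · have ht' : 0 < b⁻¹ * t := mul_pos hb' ht
    rw [radialDensity, radialDensity, Set.indicator_of_mem (Set.mem_Ioi.2 ht),
      Set.indicator_of_mem (Set.mem_Ioi.2 ht'), Real.mul_rpow hb'.le ht.le, Real.rpow_neg hb.le,
      ← Real.inv_rpow hb.le, Real.rpow_sub_one hb'.ne']
    field_simp
  · have ht' : ¬ 0 < b⁻¹ * t := fun h => ht ((mul_pos_iff_of_pos_left hb').1 h)
    rw [radialDensity, radialDensity, Set.indicator_of_notMem (show t ∉ Set.Ioi 0 from ht),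
      Set.indicator_of_notMem (show b⁻¹ * t ∉ Set.Ioi 0 from ht')]
    simp

/-- The probability that independent rescaled envelopes fall into the outage region. -/
theorem measureReal_outageRegion_eq {Ω : Type*} [MeasurableSpace Ω] {ν : Measure Ω}
    [IsProbabilityMeasure ν] {K : ℕ} {X : Fin K → Ω → ℝ} (hX : ∀ k, Measurable (X k))
    (hindep : iIndepFun X ν) {w : ℝ → ℝ} (hwm : Measurable w) {p : ℝ} (hp : 0 < p)
    (hw0 : ∀ x, 0 ≤ w x)
    (hlaw : ∀ k, Measure.map (X k) ν =
      volume.withDensity fun x => ENNReal.ofReal (w x * radialDensity p x))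
    {b : Fin K → ℝ} (hb : ∀ k, 0 < b k) (z : ℝ) :
    ν.real {ω | ∏ k, (1 + (b k * X k ω) ^ 2) < z} = (∏ k, b k ^ (-p)) *
      ∫ t in outageRegion K z, (∏ k, w ((b k)⁻¹ * t k)) * ∏ k, radialDensity p (t k) := by
  set g : Fin K → ℝ → ℝ := fun k t => b k ^ (-p) * (w ((b k)⁻¹ * t) * radialDensity p t) with hg
  have hg0 (k t) : 0 ≤ g k t :=
    mul_nonneg (Real.rpow_nonneg (hb k).le _) (mul_nonneg (hw0 _) (radialDensity_nonneg hp.le _))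
  have hgm (k) : Measurable (g k) := by
    have := measurable_radialDensity p
    fun_prop
  have hTm (k) : Measurable fun ω => b k * X k ω := (hX k).const_mul _
  have hTlaw (k) : Measure.map (fun ω => b k * X k ω) ν =
      volume.withDensity fun t => ENNReal.ofReal (g k t) := by
    have : (fun ω => b k * X k ω) = (fun x => b k * x) ∘ X k := rfl
    rw [this, ← Measure.map_map (by fun_prop) (hX k), hlaw k, map_mul_left_withDensity (hb k)]
    congr 1
    ext t
    rw [← ENNReal.ofReal_mul (inv_pos.2 (hb k)).le]
    congr 1
    rw [mul_left_comm, radialDensity_inv_mul (hb k), hg]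
    ring
  -- Integrability is free: `g k` is the density of a probability law.
  have hgi (k) : Integrable (g k) := by
    refine ⟨(hgm k).aestronglyMeasurable, ?_⟩
    rw [hasFiniteIntegral_iff_ofReal (ae_of_all _ (hg0 k))]
    have h1 := congrArg (fun m => m Set.univ) (hTlaw k)
    simp only [withDensity_apply _ MeasurableSet.univ, Measure.restrict_univ] at h1
    rw [← h1, Measure.map_apply (hTm k) MeasurableSet.univ]
    exact measure_lt_top _ _
  have hind : iIndepFun (fun k ω => b k * X k ω) ν :=
    hindep.comp (fun k x => b k * x) fun k => measurable_const_mul _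
  have hjoint := (iIndepFun_iff_map_fun_eq_pi_map fun k => (hTm k).aemeasurable).1 hind
  simp_rw [hTlaw] at hjoint
  rw [pi_withDensity_ofReal hgi hg0] at hjoint
  have hset : {ω | ∏ k, (1 + (b k * X k ω) ^ 2) < z} =
      (fun ω k => b k * X k ω) ⁻¹' outageRegion K z := rfl
  have hmeas := (isOpen_outageRegion K z).measurableSet
  rw [hset, measureReal_def, ← Measure.map_apply (measurable_pi_lambda _ hTm) hmeas, hjoint,
    withDensity_apply _ hmeas, ← integral_const_mul, integral_eq_lintegral_of_nonneg_ae]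
  · congr 1
    refine lintegral_congr fun t => ?_
    simp only [hg, Finset.prod_mul_distrib]
  · refine ae_of_all _ fun t => mul_nonneg (Finset.prod_nonneg fun k _ =>
      Real.rpow_nonneg (hb k).le _) (mul_nonneg (Finset.prod_nonneg fun k _ => hw0 _)
      (Finset.prod_nonneg fun k _ => radialDensity_nonneg hp.le _))
  · have := measurable_prod_radialDensity p K
    exact (by fun_prop : Measurable _).aestronglyMeasurable

/-- The outage probability of independent envelopes whose density behaves like
`w₀ p x^(p-1)` at the origin. -/
theorem tendsto_rpow_mul_measureReal_outageRegion {Ω : Type*} [MeasurableSpace Ω] {ν : Measure Ω}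
    [IsProbabilityMeasure ν] {K : ℕ} {X : Fin K → Ω → ℝ} (hX : ∀ k, Measurable (X k))
    (hindep : iIndepFun X ν) {w : ℝ → ℝ} (hwm : Measurable w) {p M w₀ : ℝ} (hp : 0 < p)
    (hw0 : ∀ x, 0 ≤ w x) (hwM : ∀ x, w x ≤ M) (hlim : Tendsto w (𝓝[>] 0) (𝓝 w₀))
    (hlaw : ∀ k, Measure.map (X k) ν =
      volume.withDensity fun x => ENNReal.ofReal (w x * radialDensity p x))
    {a : Fin K → ℝ} (ha : ∀ k, 0 < a k) (z : ℝ) :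
    Tendsto (fun r : ℝ => (∏ k, (r * a k) ^ p) * ν.real {ω | ∏ k, (1 + (r * a k * X k ω) ^ 2) < z})
      atTop (𝓝 (w₀ ^ K * outageVolume p K z)) := by
  have hmeas := (isOpen_outageRegion K z).measurableSet
  have hev : (fun r : ℝ => (∏ k, (r * a k) ^ p) *
      ν.real {ω | ∏ k, (1 + (r * a k * X k ω) ^ 2) < z}) =ᶠ[atTop] fun r =>
        ∫ t in outageRegion K z,
          (∏ k, w ((r * a k)⁻¹ * t k)) * ∏ k, radialDensity p (t k) := by
    filter_upwards [eventually_gt_atTop 0] with r hr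
    have hb (k) : 0 < r * a k := mul_pos hr (ha k)
    rw [measureReal_outageRegion_eq hX hindep hwm hp hw0 hlaw hb, ← mul_assoc,
      ← Finset.prod_mul_distrib, Finset.prod_eq_one, one_mul]
    intro k _
    rw [← Real.rpow_add (hb k), add_neg_cancel, Real.rpow_zero]
  refine Tendsto.congr' hev.symm ?_
  rw [outageVolume, ← integral_const_mul]
  have hM : 0 ≤ M := (hw0 0).trans (hwM 0)
  refine tendsto_integral_filter_of_dominated_convergence
    (fun t => M ^ K * ∏ k, truncatedRadialDensity p √z (t k)) ?_ ?_ ?_ ?_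
  · refine Eventually.of_forall fun r => ?_
    have := measurable_prod_radialDensity p K
    exact (by fun_prop : Measurable _).aestronglyMeasurable
  · refine Eventually.of_forall fun r => ?_
    rw [ae_restrict_iff' hmeas]
    refine ae_of_all _ fun t ht => ?_
    have h1 : 0 ≤ ∏ k, w ((r * a k)⁻¹ * t k) := Finset.prod_nonneg fun k _ => hw0 _
    have h2 : 0 ≤ ∏ k, radialDensity p (t k) :=
      Finset.prod_nonneg fun k _ => radialDensity_nonneg hp.le _
    rw [Real.norm_of_nonneg (mul_nonneg h1 h2), ← prod_radialDensity_eq_truncated le_rfl ht]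
    refine mul_le_mul_of_nonneg_right ?_ h2
    calc _ ≤ ∏ _k : Fin K, M := Finset.prod_le_prod (fun k _ => hw0 _) fun k _ => hwM _
      _ = M ^ K := by simp
  · exact ((integrable_prod_truncatedRadialDensity hp K _).const_mul _).integrableOn
  · refine ae_of_all _ fun t => ?_
    by_cases ht : ∀ k, 0 < t k
    · refine Tendsto.mul_const _ ?_
      have hpow : w₀ ^ K = ∏ _k : Fin K, w₀ := by simp
      rw [hpow]
      refine tendsto_finsetProd _ fun k _ => hlim.comp ?_
      refine tendsto_nhdsWithin_iff.2 ⟨?_, ?_⟩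
      · have h1 : Tendsto (fun r : ℝ => r * a k) atTop atTop := tendsto_id.atTop_mul_const (ha k)
        simpa using h1.inv_tendsto_atTop.mul_const (t k)
      · filter_upwards [eventually_gt_atTop 0] with r hr
        exact mul_pos (inv_pos.2 (mul_pos hr (ha k))) (ht k)
    · push Not at ht
      obtain ⟨k, hk⟩ := ht
      have : ∏ k, radialDensity p (t k) = 0 := Finset.prod_eq_zero (Finset.mem_univ k)
        (Set.indicator_of_notMem (by simpa using hk) _)
      simp [this]

/-! ### The upper incomplete Gamma function near zero -/

theorem measurable_upperGamma (a : ℝ) : Measurable (upperGamma a) := by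
  have h : upperGamma a = fun x => ∫ t, {b : ℝ × ℝ | b.1 < b.2}.indicator
      (fun b => b.2 ^ (a - 1) * Real.exp (-b.2)) (x, t) := by
    ext x
    rw [upperGamma, ← integral_indicator measurableSet_Ioi]
    refine integral_congr_ae (ae_of_all _ fun t => ?_)
    simp [Set.indicator_apply]
  rw [h]
  refine (StronglyMeasurable.integral_prod_right' (Measurable.stronglyMeasurable ?_)).measurable
  exact Measurable.indicator (by fun_prop) (measurableSet_lt measurable_fst measurable_snd)

theorem upperGamma_nonneg (a : ℝ) {x : ℝ} (hx : 0 ≤ x) : 0 ≤ upperGamma a x :=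
  setIntegral_nonneg measurableSet_Ioi fun _ ht =>
    mul_nonneg (Real.rpow_nonneg (hx.trans (Set.mem_Ioi.1 ht).le) _) (Real.exp_pos _).le

theorem integrableOn_upperGamma {a : ℝ} (ha : 0 < a) :
    IntegrableOn (fun t : ℝ => t ^ (a - 1) * Real.exp (-t)) (Set.Ioi 0) := by
  simpa only [mul_comm] using Real.GammaIntegral_convergent ha

theorem upperGamma_zero {a : ℝ} (ha : 0 < a) : upperGamma a 0 = Real.Gamma a := by
  rw [upperGamma, Real.Gamma_eq_integral ha]
  simp only [mul_comm]

theorem upperGamma_le_Gamma {a : ℝ} (ha : 0 < a) {x : ℝ} (hx : 0 ≤ x) :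
    upperGamma a x ≤ Real.Gamma a := by
  rw [← upperGamma_zero ha]
  refine setIntegral_mono_set (integrableOn_upperGamma ha) ?_
    (Set.Ioi_subset_Ioi hx).eventuallyLE
  filter_upwards [ae_restrict_mem measurableSet_Ioi] with t ht
  exact mul_nonneg (Real.rpow_nonneg (Set.mem_Ioi.1 ht).le _) (Real.exp_pos _).le

theorem tendsto_upperGamma {a : ℝ} (ha : 0 < a) :
    Tendsto (upperGamma a) (𝓝[>] 0) (𝓝 (Real.Gamma a)) := by
  have hcov := aecover_Ioi_of_Ioi (μ := volume) (l := 𝓝[>] (0 : ℝ)) (a := id) (A := 0)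
    (tendsto_id.mono_left nhdsWithin_le_nhds)
  have h := hcov.integral_tendsto_of_countably_generated (integrableOn_upperGamma ha)
  rw [← upperGamma_zero ha, upperGamma]
  refine h.congr' ?_
  filter_upwards [self_mem_nhdsWithin] with x hx
  rw [Measure.restrict_restrict measurableSet_Ioi, Set.inter_eq_left.2
    (Set.Ioi_subset_Ioi (show (0 : ℝ) ≤ id x from (Set.mem_Ioi.1 hx).le))]
  rfl

/-- Rescaling by `y` fixes the domain at `(1, ∞)`. For `a < 0` the integrand is then dominated by
`t^(a-1)`, whose integral is the limit `-1/a`. -/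
theorem rpow_neg_mul_upperGamma (a : ℝ) {y : ℝ} (hy : 0 < y) :
    y ^ (-a) * upperGamma a y = ∫ t in Set.Ioi (1 : ℝ), t ^ (a - 1) * Real.exp (-(y * t)) := by
  have h := integral_comp_mul_left_Ioi (fun t : ℝ => t ^ (a - 1) * Real.exp (-t)) 1 hy
  rw [mul_one, smul_eq_mul, ← upperGamma, eq_inv_mul_iff_mul_eq₀ hy.ne'] at h
  rw [← h, ← mul_assoc, ← Real.rpow_add_one hy.ne', ← integral_const_mul]
  refine setIntegral_congr_fun measurableSet_Ioi fun t ht => ?_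
  have ht0 : (0 : ℝ) ≤ t := zero_le_one.trans (Set.mem_Ioi.1 ht).le
  rw [Real.mul_rpow hy.le ht0, ← mul_assoc, ← mul_assoc, ← Real.rpow_add hy]
  simp

theorem rpow_neg_mul_upperGamma_le {a : ℝ} (ha : a < 0) {y : ℝ} (hy : 0 < y) :
    y ^ (-a) * upperGamma a y ≤ -1 / a := by
  have hint := integrableOn_Ioi_rpow_of_lt (a := a - 1) (by linarith) one_pos
  have hval := integral_Ioi_rpow_of_lt (a := a - 1) (by linarith) one_pos
  rw [sub_add_cancel, Real.one_rpow] at hval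
  rw [rpow_neg_mul_upperGamma a hy, ← hval]
  refine integral_mono_of_nonneg ?_ hint ?_
  · filter_upwards [ae_restrict_mem measurableSet_Ioi] with t ht
    exact mul_nonneg (Real.rpow_nonneg (zero_le_one.trans (Set.mem_Ioi.1 ht).le) _)
      (Real.exp_pos _).le
  · filter_upwards [ae_restrict_mem measurableSet_Ioi] with t ht
    have ht0 : (0 : ℝ) < t := zero_lt_one.trans (Set.mem_Ioi.1 ht)
    exact mul_le_of_le_one_right (Real.rpow_nonneg ht0.le _)
      (Real.exp_le_one_iff.2 (by have := mul_pos hy ht0; linarith))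

theorem tendsto_rpow_neg_mul_upperGamma {a : ℝ} (ha : a < 0) :
    Tendsto (fun y => y ^ (-a) * upperGamma a y) (𝓝[>] 0) (𝓝 (-1 / a)) := by
  have hint := integrableOn_Ioi_rpow_of_lt (a := a - 1) (by linarith) one_pos
  have hval := integral_Ioi_rpow_of_lt (a := a - 1) (by linarith) one_pos
  rw [sub_add_cancel, Real.one_rpow] at hval
  rw [← hval]
  have hev : (fun y => ∫ t in Set.Ioi (1 : ℝ), t ^ (a - 1) * Real.exp (-(y * t))) =ᶠ[𝓝[>] 0]
      fun y => y ^ (-a) * upperGamma a y := by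
    filter_upwards [self_mem_nhdsWithin] with y hy
    rw [rpow_neg_mul_upperGamma a hy]
  refine Tendsto.congr' hev (tendsto_integral_filter_of_dominated_convergence
    (fun t : ℝ => t ^ (a - 1)) ?_ ?_ hint ?_)
  · exact Eventually.of_forall fun y => (by fun_prop : Measurable _).aestronglyMeasurable
  · filter_upwards [self_mem_nhdsWithin] with y hy
    filter_upwards [ae_restrict_mem measurableSet_Ioi] with t ht
    have ht0 : (0 : ℝ) < t := zero_lt_one.trans (Set.mem_Ioi.1 ht)
    have hr := Real.rpow_nonneg ht0.le (a - 1)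
    rw [Real.norm_of_nonneg (mul_nonneg hr (Real.exp_pos _).le)]
    exact mul_le_of_le_one_right hr
      (Real.exp_le_one_iff.2 (by have := mul_pos (Set.mem_Ioi.1 hy) ht0; linarith))
  · refine ae_of_all _ fun t => ?_
    have hc : Continuous fun y : ℝ => t ^ (a - 1) * Real.exp (-(y * t)) := by fun_prop
    simpa using (hc.tendsto 0).mono_left nhdsWithin_le_nhds

/-! ### The fading density at the origin -/

/-- `f = w₀ p x^(p-1) (1 + o(1))` as `x → 0⁺`, with a bounded ratio on `(0, ∞)`. -/
def IsRadialDensity (f : ℝ → ENNReal) (p w₀ : ℝ) : Prop :=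
  ∃ (w : ℝ → ℝ) (M : ℝ), Measurable w ∧ (∀ x, 0 ≤ w x) ∧ (∀ x, w x ≤ M) ∧
    Tendsto w (𝓝[>] 0) (𝓝 w₀) ∧ f = fun x => ENNReal.ofReal (w x * radialDensity p x)

theorem isRadialDensity_of_pos {f : ℝ → ENNReal} {p w₀ M : ℝ} {w : ℝ → ℝ} (hw : Measurable w)
    (hw0 : ∀ x, 0 < x → 0 ≤ w x) (hwM : ∀ x, 0 < x → w x ≤ M) (hlim : Tendsto w (𝓝[>] 0) (𝓝 w₀))
    (hf : f = fun x => if 0 < x then ENNReal.ofReal (w x * (p * x ^ (p - 1))) else 0) :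
    IsRadialDensity f p w₀ := by
  have hM : 0 ≤ M := (hw0 1 one_pos).trans (hwM 1 one_pos)
  refine ⟨(Set.Ioi 0).indicator w, M, hw.indicator measurableSet_Ioi,
    Set.indicator_nonneg hw0, fun x => Set.indicator_apply_le' (hwM x) fun _ => hM, ?_, ?_⟩
  · refine hlim.congr' ?_
    filter_upwards [self_mem_nhdsWithin] with x hx
    rw [Set.indicator_of_mem hx]
  · rw [hf]
    ext x
    by_cases hx : 0 < x <;> simp [radialDensity, hx]

theorem tendsto_const_mul_rpow_nhdsGT {α β : ℝ} (hα : 0 < α) (hβ : 0 < β) :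
    Tendsto (fun x : ℝ => β * x ^ α) (𝓝[>] 0) (𝓝[>] 0) := by
  refine tendsto_nhdsWithin_iff.2 ⟨?_, ?_⟩
  · have hc : Continuous fun x : ℝ => β * x ^ α := by fun_prop (disch := exact hα.le)
    simpa [Real.zero_rpow hα.ne'] using (hc.tendsto 0).mono_left nhdsWithin_le_nhds
  · filter_upwards [self_mem_nhdsWithin] with x hx
    exact mul_pos hβ (Real.rpow_pos_of_pos hx _)

variable {α μ φ S₀ hf : ℝ}

/-- The fading density when the pointing error dominates. -/
theorem isRadialDensity_fadingPDF_of_lt (hα : 0 < α) (hμ : 0 < μ) (hS₀ : 0 < S₀)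
    (hhf : 0 < hf) (h : φ < μ * α) :
    IsRadialDensity (fadingPDF α μ φ S₀ hf) φ
      (μ ^ (φ / α) * Real.Gamma (μ - φ / α) / (hf ^ φ * S₀ ^ φ * Real.Gamma μ)) := by
  have ha : 0 < (α * μ - φ) / α := div_pos (by linarith [mul_comm α μ]) hα
  have ha' : (α * μ - φ) / α = μ - φ / α := by field_simp
  have hΓ := Real.Gamma_pos_of_pos hμ
  set β := μ / (S₀ ^ α * hf ^ α) with hβ
  have hβ0 : 0 < β := by positivity
  set c := μ ^ (φ / α) / (S₀ ^ φ * hf ^ φ * Real.Gamma μ) with hc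
  have hc0 : 0 < c := by positivity
  have hg : Measurable fun x : ℝ => upperGamma ((α * μ - φ) / α) (β * x ^ α) :=
    (measurable_upperGamma _).comp (by fun_prop)
  refine isRadialDensity_of_pos (w := fun x => c * upperGamma ((α * μ - φ) / α) (β * x ^ α))
    (M := c * Real.Gamma ((α * μ - φ) / α)) (hg.const_mul c) ?_ ?_ ?_ ?_
  · exact fun x hx => mul_nonneg hc0.le (upperGamma_nonneg _ (by positivity))
  · exact fun x hx => mul_le_mul_of_nonneg_left (upperGamma_le_Gamma ha (by positivity)) hc0.le
  · have := ((tendsto_upperGamma ha).comp (tendsto_const_mul_rpow_nhdsGT hα hβ0)).const_mul c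
    have hw₀ : μ ^ (φ / α) * Real.Gamma (μ - φ / α) / (hf ^ φ * S₀ ^ φ * Real.Gamma μ) =
        c * Real.Gamma ((α * μ - φ) / α) := by
      rw [ha', hc]; ring
    rw [hw₀]
    exact this
  · ext x
    rw [fadingPDF, hc, hβ]
    congr 2
    rw [mul_div_right_comm μ]
    ring

/-- The fading density when the multipath fading dominates. -/
theorem isRadialDensity_fadingPDF_of_gt (hα : 0 < α) (hμ : 0 < μ) (hφ : 0 < φ) (hS₀ : 0 < S₀)
    (hhf : 0 < hf) (h : μ * α < φ) :
    IsRadialDensity (fadingPDF α μ φ S₀ hf) (μ * α)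
      (φ * μ ^ (μ - 1) / ((φ - μ * α) * hf ^ (μ * α) * S₀ ^ (μ * α) * Real.Gamma μ)) := by
  set a := (α * μ - φ) / α with ha
  have ha0 : a < 0 := div_neg_of_neg_of_pos (by linarith [mul_comm α μ]) hα
  have ha' : a = μ - φ / α := by rw [ha]; field_simp
  have hφ' : 0 < φ - μ * α := by linarith
  have hΓ := Real.Gamma_pos_of_pos hμ
  set β := μ / (S₀ ^ α * hf ^ α) with hβ
  have hβ0 : 0 < β := by positivity
  -- Writing `Γ(a, y) = y^a (y^(-a) Γ(a, y))` with `y = β x^α` releases `β^a x^(μα - φ)`, which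
  -- turns `x^(φ-1)` into `x^(μα-1)`. Dividing by `μ * α` offsets the factor `p` of the radial
  -- density.
  set c := φ * μ ^ (φ / α) / (S₀ ^ φ * hf ^ φ * Real.Gamma μ) / (μ * α) * β ^ a with hc
  have hc0 : 0 < c := by positivity
  have hg : Measurable fun x : ℝ => (β * x ^ α) ^ (-a) * upperGamma a (β * x ^ α) :=
    (by fun_prop : Measurable fun x : ℝ => (β * x ^ α) ^ (-a)).mul
      ((measurable_upperGamma _).comp (by fun_prop))
  refine isRadialDensity_of_pos
    (w := fun x => c * ((β * x ^ α) ^ (-a) * upperGamma a (β * x ^ α)))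
    (M := c * (-1 / a)) (hg.const_mul c) ?_ ?_ ?_ ?_
  · exact fun x hx => mul_nonneg hc0.le (mul_nonneg (by positivity)
      (upperGamma_nonneg _ (by positivity)))
  · exact fun x hx => mul_le_mul_of_nonneg_left
      (rpow_neg_mul_upperGamma_le ha0 (by positivity)) hc0.le
  · have := ((tendsto_rpow_neg_mul_upperGamma ha0).comp
      (tendsto_const_mul_rpow_nhdsGT hα hβ0)).const_mul c
    have hβa : β ^ a = μ ^ μ / μ ^ (φ / α) * (S₀ ^ φ * hf ^ φ) / (S₀ ^ (μ * α) * hf ^ (μ * α)) := by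
      have e (x : ℝ) (hx : 0 < x) : (x ^ α) ^ a = x ^ (μ * α) / x ^ φ := by
        rw [← Real.rpow_mul hx.le, ← Real.rpow_sub hx]
        congr 1
        rw [ha', mul_sub, mul_div_cancel₀ _ hα.ne', mul_comm]
      rw [hβ, Real.div_rpow hμ.le (by positivity), Real.mul_rpow (by positivity) (by positivity),
        e _ hS₀, e _ hhf, ha', Real.rpow_sub hμ]
      field_simp
    have hinv : -1 / a = α / (φ - μ * α) := by
      rw [div_eq_div_iff ha0.ne hφ'.ne', ha]
      field_simp
      ring
    have hw₀ : φ * μ ^ (μ - 1) / ((φ - μ * α) * hf ^ (μ * α) * S₀ ^ (μ * α) * Real.Gamma μ) =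
        c * (-1 / a) := by
      rw [hinv, hc, hβa, Real.rpow_sub_one hμ.ne']
      field_simp
    rw [hw₀]
    exact this
  · ext x
    rw [fadingPDF]
    split_ifs with hx
    swap
    · rfl
    congr 1
    have hxp : (β * x ^ α) ^ (-a) = (β ^ a)⁻¹ * (x ^ φ / x ^ (μ * α)) := by
      rw [Real.mul_rpow hβ0.le (by positivity), Real.rpow_neg hβ0.le, ← Real.rpow_mul hx.le,
        ← Real.rpow_sub hx]
      congr 2
      rw [ha]
      field_simp
      ring
    have hy : μ * x ^ α / (S₀ ^ α * hf ^ α) = β * x ^ α := mul_div_right_comm _ _ _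
    rw [hxp, hc, hy, ← ha, Real.rpow_sub_one hx.ne', Real.rpow_sub_one hx.ne']
    have h1 : β ^ a ≠ 0 := by positivity
    have h2 : x ^ (μ * α) ≠ 0 := by positivity
    field_simp

/-! ### Outage asymptotics and identification of the gains -/

theorem mutualInfo_lt_iff {K : ℕ} {hl : ℂ} {ρ : Fin K → ℝ} (hρ : ∀ k, 0 ≤ ρ k) (h : Fin K → ℂ)
    (R : ℝ) :
    mutualInfo hl ρ h < R ↔ ∏ k, (1 + ρ k * ‖hl‖ ^ 2 * ‖h k‖ ^ 2) < (2 : ℝ) ^ R := by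
  have hpos (k : Fin K) : 0 < 1 + ρ k * ‖hl‖ ^ 2 * ‖h k‖ ^ 2 := by
    have := hρ k
    positivity
  rw [mutualInfo, ← Real.logb_prod _ _ fun k _ => (hpos k).ne',
    Real.logb_lt_iff_lt_rpow one_lt_two (Finset.prod_pos fun k _ => hpos k)]

/-- The high-SNR limit of the outage probability for a density `w₀ p x^(p-1) (1 + o(1))`. -/
theorem tendsto_outageProb {Ω : Type*} [MeasurableSpace Ω] {ν : Measure Ω}
    [IsProbabilityMeasure ν] {K : ℕ} {N₀ R : ℝ} {hl : ℂ} (hhl : hl ≠ 0) {hpf : Fin K → Ω → ℂ}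
    (hmeas : ∀ k, Measurable fun ω => ‖hpf k ω‖) (hindep : iIndepFun (fun k ω => ‖hpf k ω‖) ν)
    {f : ℝ → ENNReal} {p w₀ : ℝ} (hp : 0 < p) (hfd : IsRadialDensity f p w₀)
    (hlaw : ∀ k, Measure.map (fun ω => ‖hpf k ω‖) ν = volume.withDensity f)
    {q : Fin K → ℝ} (hq : ∀ k, 0 < q k) {P : ℝ → Fin K → ℝ} (hP : ∀ ρ k, P ρ k / N₀ = q k * ρ) :
    Tendsto (fun ρ : ℝ => (∏ k, (q k * ρ * ‖hl‖ ^ 2) ^ (p / 2)) *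
      outageProb ν hl N₀ hpf R (P ρ)) atTop (𝓝 (w₀ ^ K * outageVolume p K (2 ^ R))) := by
  obtain ⟨w, M, hwm, hw0, hwM, hlim, rfl⟩ := hfd
  have hln : 0 < ‖hl‖ := norm_pos_iff.2 hhl
  -- The amplitude scale is `r = √ρ`, which is why the exponent `p` in `r` becomes `p / 2` in the
  -- SNR.
  have h := (tendsto_rpow_mul_measureReal_outageRegion hmeas hindep hwm hp hw0 hwM hlim hlaw
    (a := fun k => √(q k) * ‖hl‖) (fun k => mul_pos (Real.sqrt_pos.2 (hq k)) hln)
    (2 ^ R)).comp Real.tendsto_sqrt_atTop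
  refine h.congr' ?_
  filter_upwards [eventually_gt_atTop 0] with ρ hρ
  have hsq (k : Fin K) : (√ρ * (√(q k) * ‖hl‖)) ^ 2 = q k * ρ * ‖hl‖ ^ 2 := by
    rw [mul_pow, mul_pow, Real.sq_sqrt hρ.le, Real.sq_sqrt (hq k).le]; ring
  simp only [Function.comp_apply]
  congr 1
  · refine Finset.prod_congr rfl fun k _ => ?_
    rw [← hsq, ← Real.rpow_natCast, ← Real.rpow_mul (by positivity)]
    congr 1; push_cast; ring
  · rw [outageProb]
    congr 1
    ext ω
    simp only [Set.mem_ofPred_eq, hP]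
    rw [mutualInfo_lt_iff fun k => (mul_pos (hq k) hρ).le]
    simp only [mul_pow _ ‖hpf _ ω‖, hsq]

/-- The logarithm of the convergent product stays bounded, so dividing by `log ρ` leaves only the
exponent `d`. -/
theorem isEquivalent_and_tendsto_log {u v : ℝ → ℝ} {c e d : ℝ} (hc : 0 < c) (he : 0 < e)
    (h : Tendsto (fun ρ => e * ρ ^ d * u ρ) atTop (𝓝 c))
    (hv : ∀ᶠ ρ in atTop, v ρ = c * (e * ρ ^ d)⁻¹) :
    u ~[atTop] v ∧ Tendsto (fun ρ => -(Real.log (u ρ) / Real.log ρ)) atTop (𝓝 d) := by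
  have hev : ∀ᶠ ρ : ℝ in atTop, 0 < e * ρ ^ d := by
    filter_upwards [eventually_gt_atTop 0] with ρ hρ
    positivity
  constructor
  · rw [isEquivalent_iff_tendsto_one]
    · have h1 := h.div_const c
      rw [div_self hc.ne'] at h1
      refine h1.congr' ?_
      filter_upwards [hev, hv] with ρ h2 h3
      rw [Pi.div_apply, h3]
      field_simp
    · filter_upwards [hev, hv] with ρ h2 h3
      rw [h3]; positivity
  · have hlog := ((Real.continuousAt_log hc.ne').tendsto.comp h).sub_const (Real.log e)
    have hq := (hlog.div_atTop Real.tendsto_log_atTop).const_sub d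
    rw [sub_zero] at hq
    refine hq.congr' ?_
    filter_upwards [hev, h.eventually (lt_mem_nhds hc), eventually_gt_atTop 1] with ρ h2 h3 h4
    have hu : 0 < u ρ := (pos_iff_pos_of_mul_pos h3).1 h2
    have hρ : 0 < ρ := by linarith
    have hl := Real.log_pos h4
    rw [Function.comp_apply, Real.log_mul h2.ne' hu.ne',
      Real.log_mul he.ne' (Real.rpow_pos_of_pos hρ d).ne', Real.log_rpow hρ]
    field_simp
    ring

theorem prod_rpow_eq {K : ℕ} {q : Fin K → ℝ} (hq : ∀ k, 0 < q k) {p ρ l : ℝ} (hρ : 0 < ρ)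
    (hl : 0 < l) :
    ∏ k, (q k * ρ * l ^ 2) ^ (p / 2) =
      (∏ k, q k) ^ (p / 2) * (l ^ p) ^ K * ρ ^ ((K : ℝ) * p / 2) := by
  have hk (k : Fin K) : (q k * ρ * l ^ 2) ^ (p / 2) = q k ^ (p / 2) * (ρ ^ (p / 2) * l ^ p) := by
    have := (hq k).le
    rw [Real.mul_rpow (by positivity) (by positivity), Real.mul_rpow (by positivity) hρ.le,
      ← Real.rpow_natCast, ← Real.rpow_mul hl.le, mul_assoc]
    congr 3; push_cast; ring
  have hρK : ρ ^ ((K : ℝ) * p / 2) = (ρ ^ (p / 2)) ^ K := by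
    rw [← Real.rpow_natCast, ← Real.rpow_mul hρ.le]; congr 1; ring
  rw [Finset.prod_congr rfl fun k _ => hk k, Finset.prod_mul_distrib,
    Real.finsetProd_rpow _ _ fun k _ => (hq k).le, hρK]
  simp only [Finset.prod_const, Finset.card_univ, Fintype.card_fin, mul_pow]
  ring

/-- The powers of `N₀` in the impact factor exactly convert the powers `P k` into SNRs. -/
theorem gain_mul_prod_rpow {K : ℕ} {q P : Fin K → ℝ} (hq : ∀ k, 0 < q k) {N₀ p ρ l w₀ : ℝ}
    (hN₀ : 0 < N₀) (hρ : 0 < ρ) (hl : 0 < l) (hP : ∀ k, P k / N₀ = q k * ρ) :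
    (w₀ * N₀ ^ (p / 2) / l ^ p) ^ K * (∏ k, P k) ^ (-(p / 2)) =
      w₀ ^ K * ((∏ k, q k) ^ (p / 2) * (l ^ p) ^ K * ρ ^ ((K : ℝ) * p / 2))⁻¹ := by
  have hPk (k : Fin K) : P k = N₀ * (q k * ρ) := by
    rw [← hP k, mul_div_cancel₀ _ hN₀.ne']
  have hQ : 0 < ∏ k, q k := Finset.prod_pos fun k _ => hq k
  have hprod : ∏ k, P k = N₀ ^ K * ((∏ k, q k) * ρ ^ K) := by
    rw [Finset.prod_congr rfl fun k _ => hPk k, Finset.prod_mul_distrib, Finset.prod_mul_distrib]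
    simp
  have hpow (x : ℝ) (hx : 0 < x) : (x ^ K) ^ (-(p / 2)) = ((x ^ (p / 2)) ^ K)⁻¹ := by
    rw [Real.rpow_neg (by positivity), Real.rpow_pow_comm hx.le]
  have hρK : ρ ^ ((K : ℝ) * p / 2) = (ρ ^ (p / 2)) ^ K := by
    rw [← Real.rpow_natCast, ← Real.rpow_mul hρ.le]; congr 1; ring
  rw [hprod, Real.mul_rpow (by positivity) (by positivity),
    Real.mul_rpow (by positivity) (by positivity), hpow _ hN₀, hpow _ hρ, hρK,
    Real.rpow_neg hQ.le, div_pow, mul_pow]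
  field_simp

theorem calG_eq {K : ℕ} (hK : 1 ≤ K) {α μ φ : ℝ} (hα : 0 < α) (hμ : 0 < μ) (hφ : 0 < φ) (R : ℝ) :
    calG K α μ φ R = outageVolume (min φ (α * μ)) K (2 ^ R) := by
  have key {δ : ℝ} (hδ : 0 < δ) :
      Real.Gamma (δ + 1) ^ K * (codingG K δ R).re = outageVolume (2 * δ) K (2 ^ R) := by
    have hΓ : 0 < Real.Gamma (δ + 1) := Real.Gamma_pos_of_pos (by linarith)
    rw [(meijerGConverges_and_codingG_eq hK hδ R).2, Complex.ofReal_re, mul_div_cancel₀]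
    positivity
  unfold calG
  split_ifs with h
  · rw [key (by positivity), min_eq_left (by linarith [mul_comm α μ])]
    congr 1; ring
  · rw [key (by positivity), min_eq_right (by linarith [mul_comm α μ])]
    congr 1; ring

theorem exists_isRadialDensity_fadingPDF {α μ φ S₀ hf : ℝ} (hα : 0 < α) (hμ : 0 < μ) (hφ : 0 < φ)
    (hS₀ : 0 < S₀) (hhf : 0 < hf) (hne : μ * α - φ ≠ 0) (K : ℕ) (N₀ : ℝ) (hl : ℂ) :
    ∃ w₀, 0 < w₀ ∧ IsRadialDensity (fadingPDF α μ φ S₀ hf) (min φ (α * μ)) w₀ ∧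
      impactA K α μ φ S₀ hf N₀ hl =
        (w₀ * N₀ ^ (min φ (α * μ) / 2) / ‖hl‖ ^ min φ (α * μ)) ^ K := by
  have hΓ := Real.Gamma_pos_of_pos hμ
  rw [impactA, mul_comm α μ]
  split_ifs with h
  · have hlt : φ < μ * α := by linarith
    rw [min_eq_left hlt.le]
    refine ⟨_, ?_, isRadialDensity_fadingPDF_of_lt hα hμ hS₀ hhf hlt, ?_⟩
    · have := Real.Gamma_pos_of_pos (show 0 < μ - φ / α by rwa [sub_pos, div_lt_iff₀ hα])
      positivity
    · congr 1
      rw [div_mul_eq_mul_div, div_div]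
      congr 1; ring
  · have hlt : μ * α < φ := lt_of_le_of_ne (by linarith) fun h => hne (by linarith)
    have : 0 < φ - μ * α := by linarith
    rw [min_eq_right hlt.le]
    refine ⟨_, ?_, isRadialDensity_fadingPDF_of_gt hα hμ hφ hS₀ hhf hlt, ?_⟩
    · positivity
    · congr 1
      rw [div_mul_eq_mul_div, div_div]
      congr 1; ring

theorem impactL_eq {K : ℕ} (α μ φ : ℝ) (P : Fin K → ℝ) :
    impactL α μ φ P = (∏ k, P k) ^ (-(min φ (α * μ) / 2)) := by
  rw [impactL, mul_comm α μ]
  split_ifs with h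
  · rw [min_eq_left (by linarith)]
  · rw [min_eq_right (by linarith)]

end HARQ

end

theorem theorem1 {Ω : Type*} [MeasurableSpace Ω] (ν : Measure Ω) [IsProbabilityMeasure ν]
    (K : ℕ) (hK : 1 ≤ K)
    -- fading, pointing-error, path-gain and noise parameters, and the rate
    (α μ φ S₀ hf N₀ R : ℝ) (hl : ℂ)
    (hα : 0 < α) (hμ : 0 < μ) (hφ : 0 < φ) (hS₀ : 0 < S₀) (hhf : 0 < hf) (hN₀ : 0 < N₀)
    (hR : 0 < R) (hhl : hl ≠ 0) (hne : μ * α - φ ≠ 0)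
    -- independent channel coefficients, whose envelopes have the density of the model
    (hpf : Fin K → Ω → ℂ)
    (hmeas : ∀ k, Measurable fun ω => ‖hpf k ω‖)
    (hindep : iIndepFun (fun k ω => ‖hpf k ω‖) ν)
    (hlaw : ∀ k, Measure.map (fun ω => ‖hpf k ω‖) ν =
      (volume : Measure ℝ).withDensity (HARQ.fadingPDF α μ φ S₀ hf))
    -- powers `P k` with SNRs `ρₖ = Pₖ / N₀ = qₖ ρ`
    (q : Fin K → ℝ) (hq : ∀ k, 0 < q k)
    (P : ℝ → Fin K → ℝ) (hP : ∀ ρ k, P ρ k / N₀ = q k * ρ) :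
    -- the Meijer G-value is a convergent integral, is real, and `𝒢_K(2^R)` is positive
    (HARQ.MeijerGConverges 0 K (HARQ.upperParams K (min φ (α * μ) / 2)) (HARQ.lowerParams K)
        (((2 : ℝ) ^ R : ℝ) : ℂ) ∧
      (HARQ.codingG K (min φ (α * μ) / 2) R).im = 0 ∧ 0 < HARQ.calG K α μ φ R) ∧
    -- the asymptotic outage probability
    (fun ρ : ℝ => HARQ.outageProb ν hl N₀ hpf R (P ρ)) ~[atTop]
      (fun ρ : ℝ => HARQ.impactA K α μ φ S₀ hf N₀ hl * HARQ.impactL α μ φ (P ρ) *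
        HARQ.codingGain K α μ φ R ^ (-HARQ.diversity K α μ φ)) ∧
    -- `𝒟` is the diversity order
    Tendsto (fun ρ : ℝ => -(Real.log (HARQ.outageProb ν hl N₀ hpf R (P ρ)) / Real.log ρ))
      atTop (𝓝 (HARQ.diversity K α μ φ)) := by
  have hp : 0 < min φ (α * μ) := by positivity
  have hln : 0 < ‖hl‖ := norm_pos_iff.2 hhl
  obtain ⟨hconv, hcod⟩ :=
    HARQ.meijerGConverges_and_codingG_eq hK (δ := min φ (α * μ) / 2) (by positivity) R
  have hV := HARQ.outageVolume_pos hp K (Real.one_lt_rpow one_lt_two hR)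
  have hG := HARQ.calG_eq hK hα hμ hφ R
  have hGpos : 0 < HARQ.calG K α μ φ R := hG ▸ hV
  refine ⟨⟨hconv, by rw [hcod, Complex.ofReal_im], hGpos⟩, ?_⟩
  obtain ⟨w₀, hw₀, hfd, hA⟩ :=
    HARQ.exists_isRadialDensity_fadingPDF hα hμ hφ hS₀ hhf hne K N₀ hl
  have hlim := HARQ.tendsto_outageProb (R := R) hhl hmeas hindep hp hfd hlaw hq hP
  have hQ : 0 < ∏ k, q k := Finset.prod_pos fun k _ => hq k
  refine HARQ.isEquivalent_and_tendsto_log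
    (c := w₀ ^ K * HARQ.outageVolume (min φ (α * μ)) K (2 ^ R))
    (e := (∏ k, q k) ^ (min φ (α * μ) / 2) * (‖hl‖ ^ min φ (α * μ)) ^ K)
    (by positivity) (by positivity) (hlim.congr' ?_) ?_
  · filter_upwards [eventually_gt_atTop 0] with ρ hρ
    rw [HARQ.prod_rpow_eq hq hρ hln, HARQ.diversity]
  · filter_upwards [eventually_gt_atTop 0] with ρ hρ
    have hD : HARQ.diversity K α μ φ ≠ 0 := by
      have : (0 : ℝ) < K := by exact_mod_cast hK
      rw [HARQ.diversity]
      positivity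
    -- The exponents `-1/𝒟` and `-𝒟` cancel, so the coding-gain factor is `calG`, that is, the
    -- outage volume.
    rw [HARQ.codingGain, ← Real.rpow_mul hGpos.le, neg_div, neg_mul_neg, one_div_mul_cancel hD,
      Real.rpow_one, hA, HARQ.impactL_eq, HARQ.gain_mul_prod_rpow hq hN₀ hρ hln (hP ρ), hG,
      HARQ.diversity]
    ring
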